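/- Let $\Bbbk$ be an algebraically closed field of characteristic $0$, and let $A=\bigoplus_{i\ge 0}A_i$ be a connected graded $\Bbbk$-algebra ($A_0=\Bbbk$) with $V:=A_1$ finite dimensional, $n=\dim V$. Assume that $A$ is Koszul, i.e. the right module $\Bbbk_A=A/A_{\ge1}$ has a resolution $\cdots\to P_1\to P_0\to\Bbbk_A\to0$ by graded projective right modules and degree-preserving maps, with $P_i$ generated in degree $i$. Let $f\in A_2$ be regular (neither a left nor a right zero divisor) and normal ($Af=fA$), and let $B=A/(f)$ with the induced grading. Definitions (for $A$, and likewise for $B$). Write the linear free resolution of $\Bbbk_A$ as $$\cdots\to A(-2)^{s_2}\xrightarrow{d_2}A(-1)^{s_1}\xrightarrow{d_1}A\to0,$$ with $d_i$ a matrix over $A_1$ acting on column vectors by left multiplication, and the linear free resolution of the left module ${}_A\Bbbk$ as $\cdots\to A(-2)^{s_2}\xrightarrow{h_2}A(-1)^{s_1}\xrightarrow{h_1}A\to0$, with $h_i$ a matrix over $A_1$ acting on row vectors by right multiplication. For a matrix $M$ over $V$ and $p\in\mathbb P(V^*)$ let $M_p$ be the matrix over $\Bbbk$ obtained by evaluating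 the entries at $p$. Let $X_A$ and ${}_AX$ be the zero loci in $\mathbb P(V^*)$ of the $n\times n$ minors of $d_2$ and of $h_2$ respectively. * $A$ is *semi-standard* if $X_A={}_AX$. * $A$ is *point-exact up to degree* $\ell$ if for all $1\le i\le\ell$ one has $\operatorname{rank}(d_i)_p+\operatorname{rank}(d_{i+1})_p=s_i$ for every $p\in X_A$, and $\operatorname{rank}(h_i)_p+\operatorname{rank}(h_{i+1})_p=s_i$ for every $p\in{}_AX$. * $A$ satisfies *(G1)* if there are a projective variety $E\subseteq\mathbb P(V^*)$ (the zero locus of a set of homogeneous polynomials, possibly reducible or empty) and an automorphism $\sigma$ of the variety $E$ such that $$\{(p,q)\in\mathbb P(V^*)\times\mathbb P(V^*)\mid g(p,q)=0\text{ for all }g\in R\}=\{(p,\sigma(p))\mid p\in E\},$$ where $R=\ker(V\otimes V\to A_2)$ is the space of quadratic relations, viewed as bilinear forms on $V^*$. These notions do not depend on the chosen resolutions. **Theorem.** Let $\ell\ge2$. 1. If $A$ is semi-standard and point-exact up to degree $\ell$, then $B$ is also semi-standard and point-exact up to degree $\ell$. 2. If $A$ satisfies (G1) and is point-exact up to degree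 $\ell$, then $B$ also satisfies (G1) and is point-exact up to degree $\ell$. -/

import Mathlib

open scoped LinearAlgebra.Projectivization TensorProduct

universe u v

namespace PointExact

noncomputable section

/-! ### Projective varieties in `ℙ(V*)`

A vector `v : V` is a linear form on the dual `V*`, so `MvPolynomial V k` (one variable `X v` for
every `v : V`) acts on `V*` by `X v ↦ p v`. The polynomial functions obtained in this way, and the
homogeneous ones of each degree, are exactly those of `k[x₁, …, xₙ]` for a basis `x₁, …, xₙ` of
`V`; no basis has to be chosen. -/

section Varieties

variable {k : Type u} [Field k] {V : Type v} [AddCommGroup V] [Module k V]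

/-- The value of a polynomial at the chosen representative of a point of `ℙ(V*)`. For a homogeneous
polynomial, whether it vanishes does not depend on the representative. -/
def polyEval (p : ℙ k (Module.Dual k V)) (F : MvPolynomial V k) : k :=
  MvPolynomial.aeval (fun v : V => p.rep v) F

/-- A (not necessarily irreducible, possibly empty) projective variety in `ℙ(V*)`: the common zero
locus of a set of homogeneous polynomials. -/
def IsProjectiveVariety (E : Set (ℙ k (Module.Dual k V))) : Prop :=
  ∃ S : Set (MvPolynomial V k), (∀ F ∈ S, ∃ d : ℕ, F.IsHomogeneous d) ∧
    E = {p | ∀ F ∈ S, polyEval p F = 0}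

/-- The functional `v ↦ F_v(q)`. If `x₁, …, xₙ` is a basis of `V`, it is the vector with
coordinates `(F_{x₁}(q), …, F_{xₙ}(q))`. -/
def tupleEval (F : V →ₗ[k] MvPolynomial V k) (q : ℙ k (Module.Dual k V)) : Module.Dual k V :=
  (MvPolynomial.aeval (fun v : V => q.rep v)).toLinearMap ∘ₗ F

/-- `φ : E → ℙ(V*)` is a morphism of varieties: every point of `E` has a (principal) open
neighbourhood `{G ≠ 0}` in `E` on which `φ` is `q ↦ (F₁(q) : ⋯ : Fₙ(q))` with homogeneous
polynomials `Fᵢ` of the same degree without common zero there. -/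
def IsRegularMap (E : Set (ℙ k (Module.Dual k V))) (φ : E → ℙ k (Module.Dual k V)) : Prop :=
  ∀ p : E, ∃ (e d : ℕ) (G : MvPolynomial V k) (F : V →ₗ[k] MvPolynomial V k),
    G.IsHomogeneous e ∧ (∀ v, (F v).IsHomogeneous d) ∧ polyEval p.1 G ≠ 0 ∧
    ∀ q : E, polyEval q.1 G ≠ 0 →
      ∃ h : tupleEval F q.1 ≠ 0, φ q = Projectivization.mk k (tupleEval F q.1) h

/-- `σ ∈ Aut_k(E)`. -/
def IsVarietyAut (E : Set (ℙ k (Module.Dual k V))) (σ : E ≃ E) : Prop :=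
  IsRegularMap E (fun p => (σ p).1) ∧ IsRegularMap E (fun p => (σ.symm p).1)

/-- `𝒱(R) ⊆ ℙ(V*) × ℙ(V*)`: the zero locus of the bilinear forms `(v ⊗ w)(p, q) = p(v) q(w)`
given by the elements of `R ⊆ V ⊗ V`. -/
def bilinearZeros (R : Submodule k (V ⊗[k] V)) :
    Set (ℙ k (Module.Dual k V) × ℙ k (Module.Dual k V)) :=
  {pq | ∀ f ∈ R, TensorProduct.dualDistrib k V V (pq.1.rep ⊗ₜ[k] pq.2.rep) f = 0}

/-- `M_p`, for a matrix `M` over `V` and a point `p` of `ℙ(V*)` (well defined up to a nonzero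
scalar). -/
def evalMatrix {m n : Type*} (M : Matrix m n V) (p : ℙ k (Module.Dual k V)) : Matrix m n k :=
  M.map (fun v => p.rep v)

/-- `X^t_M ⊆ ℙ(V*)`: the locus where all `t`-minors of `M` vanish. -/
def minorLocus {a b : ℕ} (t : ℕ) (M : Matrix (Fin a) (Fin b) V) :
    Set (ℙ k (Module.Dual k V)) :=
  {p | ∀ (r : Fin t ↪o Fin a) (c : Fin t ↪o Fin b), ((evalMatrix M p).submatrix r c).det = 0}

end Varieties

/-! ### Graded algebras, linear resolutions, Koszul algebras -/

section Algebras

variable {k : Type u} [Field k] {A : Type v} [Ring A] [Algebra k A]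

/-- A graded algebra (graded by `ℕ`) is connected if `A₀ = k`. -/
def IsConnectedGraded (𝒜 : ℕ → Submodule k A) : Prop :=
  Function.Injective (algebraMap k A) ∧ 𝒜 0 = LinearMap.range (Algebra.linearMap k A)

/-- `f` is normal if `Af = fA`. -/
def IsNormalElement (f : A) : Prop :=
  Set.range (fun a : A => a * f) = Set.range (fun a : A => f * a)

/-- `A_{≥ 1}`, as a subspace. -/
def augmentation (𝒜 : ℕ → Submodule k A) : Submodule k A :=
  ⨆ i : ℕ, 𝒜 (i + 1)

/-- `A_{≥ 1}`, as a right ideal. -/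
def rightAugmentation (𝒜 : ℕ → Submodule k A) : Submodule Aᵐᵒᵖ A :=
  Submodule.span Aᵐᵒᵖ (augmentation 𝒜 : Set A)

/-- A linear projective resolution of the right module `k_A = A / A_{≥ 1}`: an exact sequence
`⋯ → P₂ → P₁ → P₀ → k_A → 0` of graded right `A`-modules and degree preserving maps, where `Pᵢ` is
projective and generated by its component of degree `i`. (Right `A`-modules are `Aᵐᵒᵖ`-modules.
As `A` lives in degrees `≥ 0`, such a `Pᵢ` lives in degrees `≥ i`, so it is graded by `ℕ`.) -/
structure LinearProjectiveResolution (𝒜 : ℕ → Submodule k A) where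
  /-- the modules `Pᵢ` -/
  P : ℕ → Type v
  [addCommGroup : ∀ i, AddCommGroup (P i)]
  [module : ∀ i, Module k (P i)]
  [rightModule : ∀ i, Module Aᵐᵒᵖ (P i)]
  [isScalarTower : ∀ i, IsScalarTower k Aᵐᵒᵖ (P i)]
  /-- `component i j` is the degree `j` component of `Pᵢ` -/
  component : ∀ i, ℕ → Submodule k (P i)
  isInternal : ∀ i, DirectSum.IsInternal (component i)
  smul_mem : ∀ i j l (a : A) (x : P i), a ∈ 𝒜 j → x ∈ component i l →
    MulOpposite.op a • x ∈ component i (l + j)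
  projective : ∀ i, Module.Projective Aᵐᵒᵖ (P i)
  generated : ∀ i, Submodule.span Aᵐᵒᵖ (component i i : Set (P i)) = ⊤
  /-- the differential `d_{i+1} : P_{i+1} → Pᵢ` -/
  d : ∀ i, P (i + 1) →ₗ[Aᵐᵒᵖ] P i
  d_mem : ∀ i j (x : P (i + 1)), x ∈ component (i + 1) j → d i x ∈ component i j
  /-- the augmentation `P₀ → k_A` -/
  ε : P 0 →ₗ[Aᵐᵒᵖ] (A ⧸ rightAugmentation 𝒜)
  /-- `ε` preserves degrees (`k_A` is concentrated in degree `0`) -/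
  ε_eq_zero : ∀ j (x : P 0), x ∈ component 0 (j + 1) → ε x = 0
  exact : ∀ i, Function.Exact (d (i + 1)) (d i)
  exact_zero : Function.Exact (d 0) ε
  surjective : Function.Surjective ε

/-- `A` is Koszul if `k_A` has a linear projective resolution. -/
def IsKoszul (𝒜 : ℕ → Submodule k A) : Prop :=
  Nonempty (LinearProjectiveResolution 𝒜)

/-- A linear resolution `⋯ → A(-2)^{s₂} → A(-1)^{s₁} → A → 0` of the right module `k_A` by free
modules of finite rank. Elements of `A^{sᵢ}` are column vectors, and the differentials are left
multiplications by matrices over `A₁`. -/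
structure RightLinearResolution (𝒜 : ℕ → Submodule k A) where
  /-- the ranks `sᵢ` -/
  s : ℕ → ℕ
  /-- `d i` is the matrix of `d_{i+1} : A(-i-1)^{s_{i+1}} → A(-i)^{sᵢ}` -/
  d : ∀ i, Matrix (Fin (s i)) (Fin (s (i + 1))) (𝒜 1)
  s_zero : s 0 = 1
  /-- the cokernel of `d₁` is `k_A = A / A_{≥ 1}` -/
  exact_zero : ∀ x : Fin (s 0) → A,
    (∃ y, ((d 0).map (fun a => (a : A))).mulVec y = x) ↔ ∀ j, x j ∈ augmentation 𝒜
  /-- exactness at `A(-i-1)^{s_{i+1}}` -/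
  exact : ∀ i (x : Fin (s (i + 1)) → A),
    ((d i).map (fun a => (a : A))).mulVec x = 0 ↔
      ∃ y, ((d (i + 1)).map (fun a => (a : A))).mulVec y = x

/-- A linear resolution `⋯ → A(-2)^{s₂} → A(-1)^{s₁} → A → 0` of the left module `_A k` by free
modules of finite rank. Elements of `A^{sᵢ}` are row vectors, and the differentials are right
multiplications by matrices over `A₁`. -/
structure LeftLinearResolution (𝒜 : ℕ → Submodule k A) where
  /-- the ranks `sᵢ` -/
  s : ℕ → ℕ
  /-- `h i` is the matrix of `h_{i+1} : A(-i-1)^{s_{i+1}} → A(-i)^{sᵢ}` -/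
  h : ∀ i, Matrix (Fin (s (i + 1))) (Fin (s i)) (𝒜 1)
  s_zero : s 0 = 1
  /-- the cokernel of `h₁` is `_A k = A / A_{≥ 1}` -/
  exact_zero : ∀ x : Fin (s 0) → A,
    (∃ y, ((h 0).map (fun a => (a : A))).vecMul y = x) ↔ ∀ j, x j ∈ augmentation 𝒜
  /-- exactness at `A(-i-1)^{s_{i+1}}` -/
  exact : ∀ i (x : Fin (s (i + 1)) → A),
    ((h i).map (fun a => (a : A))).vecMul x = 0 ↔
      ∃ y, ((h (i + 1)).map (fun a => (a : A))).vecMul y = x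

/-- `X_A = X_{d₂}`: the zero locus in `ℙ(A₁*)` of the `n`-minors of `d₂`, where `n = dim A₁`. -/
def RightLinearResolution.X {𝒜 : ℕ → Submodule k A} (P : RightLinearResolution 𝒜) :
    Set (ℙ k (Module.Dual k (𝒜 1))) :=
  minorLocus (Module.finrank k (𝒜 1)) (P.d 1)

/-- `_A X = X_{h₂}`: the zero locus in `ℙ(A₁*)` of the `n`-minors of `h₂`, where `n = dim A₁`. -/
def LeftLinearResolution.X {𝒜 : ℕ → Submodule k A} (Q : LeftLinearResolution 𝒜) :
    Set (ℙ k (Module.Dual k (𝒜 1))) :=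
  minorLocus (Module.finrank k (𝒜 1)) (Q.h 1)

/-! Linear resolutions of `k_A` and of `_A k` exist for a Koszul algebra and are unique up to an
isomorphism given by invertible matrices over `k`. So the following notions do not depend on the
linear resolution that is used. -/

/-- `A` is semi-standard if `X_A = _A X`. -/
def IsSemiStandard (𝒜 : ℕ → Submodule k A) : Prop :=
  ∃ (P : RightLinearResolution 𝒜) (Q : LeftLinearResolution 𝒜), P.X = Q.X

/-- `rank (d_i)_p + rank (d_{i+1})_p = s_i` for all `p ∈ X_A` and all `1 ≤ i ≤ ℓ`
(here `i` is `j + 1`). -/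
def IsRightPointExactUpTo (𝒜 : ℕ → Submodule k A) (ℓ : ℕ) : Prop :=
  ∃ P : RightLinearResolution 𝒜, ∀ j, j + 1 ≤ ℓ → ∀ p ∈ P.X,
    (evalMatrix (P.d j) p).rank + (evalMatrix (P.d (j + 1)) p).rank = P.s (j + 1)

/-- `rank (h_i)_p + rank (h_{i+1})_p = s_i` for all `p ∈ _A X` and all `1 ≤ i ≤ ℓ`
(here `i` is `j + 1`). -/
def IsLeftPointExactUpTo (𝒜 : ℕ → Submodule k A) (ℓ : ℕ) : Prop :=
  ∃ Q : LeftLinearResolution 𝒜, ∀ j, j + 1 ≤ ℓ → ∀ p ∈ Q.X,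
    (evalMatrix (Q.h j) p).rank + (evalMatrix (Q.h (j + 1)) p).rank = Q.s (j + 1)

/-- `A` is point-exact up to degree `ℓ`. -/
def IsPointExactUpTo (𝒜 : ℕ → Submodule k A) (ℓ : ℕ) : Prop :=
  IsRightPointExactUpTo 𝒜 ℓ ∧ IsLeftPointExactUpTo 𝒜 ℓ

/-- The quadratic relations `R ⊆ A₁ ⊗ A₁`: the kernel of the multiplication `A₁ ⊗ A₁ → A₂`.
If `A = T(V)/(R)` is quadratic, then `V = A₁` and this is the space of relations. -/
def relations (𝒜 : ℕ → Submodule k A) : Submodule k (𝒜 1 ⊗[k] 𝒜 1) :=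
  LinearMap.ker (LinearMap.mul' k A ∘ₗ TensorProduct.map (𝒜 1).subtype (𝒜 1).subtype)

/-- The (G1) condition of a quadratic algebra: `𝒱(R)` is the graph of an automorphism `σ` of a
projective variety `E ⊆ ℙ(A₁*)`. -/
def SatisfiesG1 (𝒜 : ℕ → Submodule k A) : Prop :=
  ∃ (E : Set (ℙ k (Module.Dual k (𝒜 1)))) (σ : E ≃ E),
    IsProjectiveVariety E ∧ IsVarietyAut E σ ∧
    bilinearZeros (relations 𝒜) = {pq | ∃ p : E, pq = (p.1, (σ p).1)}

/-- The quotient algebra `A/(f)` by the two-sided ideal generated by `f`. -/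
abbrev QuotientBy (f : A) : Type v :=
  (TwoSidedIdeal.span {f}).ringCon.Quotient

/-- The grading of `A/(f)` induced by that of `A` (for homogeneous `f`). -/
def quotientGrading (𝒜 : ℕ → Submodule k A) (f : A) : ℕ → Submodule k (QuotientBy f) :=
  fun i => (𝒜 i).map ((TwoSidedIdeal.span {f}).ringCon.mkₐ k).toLinearMap

end Algebras

end

end PointExact

/-! Call `(q, p)` successive over an algebra if all its quadratic relations vanish there
(`RelationZero`). The rows of the second matrix of a linear resolution, evaluated at `p`, are
dependent exactly when `p` has a predecessor. So the right locus consists of the points with a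
predecessor and the left locus of those with a successor. Both semi-standardness and (G1) imply that
these two kinds of points coincide (`IsPointSymmetric`).

Over `B = A/(f)` there is one more relation, `f` itself. The key to the geometry is
`relationZero_quotient_chain`: if `r, q, p` are successive over `A`, then `f(r, q) = 0` if and only
if `f(q, p) = 0`. Hence point symmetry passes to `B`, and under (G1) the automorphism restricts to
the points of `B`.

A regular normal `f` defines an endomorphism `τ` by `a f = f τ(a)`. A linear resolution `d` over
`A`, together with homotopies `σ` for multiplication by `f`, gives a Shamash-type resolution over
`B` with block triangular differentials `D (m + 2) = (d m, σ m; 0, τ(D m))`. Consecutive products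
over `A` are `(0 | f)`. Since `f` has degree two, the homotopies can be chosen with entries in `V`,
so the new resolution is linear.

For the ranks (`rank_shamashD`), let `Y` be the set of nonzero functionals having a predecessor over
`B`. Point-exactness makes the rank of each `d j` constant on `Y`. The triangular shape bounds the
rank of `D (m + 2)` at `p` from below. The vanishing of `D (m + 1)` at `q` times `D (m + 2)` at `p`,
for a predecessor `q` of `p`, bounds it from above. Since `Y` is stable under `τ` and contains a
predecessor of each of its elements, induction applies, and the two bounds agree. Left modules are
handled by passing to the opposite algebra. -/

namespace PointExact

open Matrix DirectSum MulOpposite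

/-! ### Ranks, minors and block triangular matrices. -/

section Rank

variable {k : Type*} [Field k]

theorem exists_orderEmb_linearIndependent_col {m : Type*} [Fintype m] {b t : ℕ}
    (N : Matrix m (Fin b) k) (h : t ≤ N.rank) :
    ∃ c : Fin t ↪o Fin b, LinearIndependent k (N.submatrix id c).col := by
  classical
  obtain ⟨κ, a, ha, hspan, hli⟩ := exists_linearIndependent' k N.col
  have : Finite κ := Finite.of_injective a ha
  cases nonempty_fintype κ
  have hcard : Fintype.card κ = N.rank := by
    rw [rank_eq_finrank_span_cols, ← hspan, finrank_span_eq_card hli]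
  obtain ⟨u, hu, hut⟩ := Finset.exists_subset_card_eq
    (s := Finset.univ.image a) (n := t) (by
      rw [Finset.card_image_of_injective _ ha, Finset.card_univ, hcard]; exact h)
  have hmem : ∀ i : Fin t, ∃ x : κ, a x = u.orderEmbOfFin hut i := fun i => by
    simpa using hu (Finset.orderEmbOfFin_mem u hut i)
  choose g hg using hmem
  have hginj : Function.Injective g := fun i j hij =>
    (u.orderEmbOfFin hut).injective (by rw [← hg, ← hg, hij])
  refine ⟨u.orderEmbOfFin hut, ?_⟩
  have heq : (N.submatrix id (u.orderEmbOfFin hut)).col = (N.col ∘ a) ∘ g := by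
    ext i j
    exact congrArg (N j) (hg i).symm
  rw [heq]
  exact hli.comp g hginj

/-- A matrix of rank at least `t` has `t` independent columns, and the resulting matrix has `t`
independent rows. This converts determinantal loci into rank conditions. -/
theorem rank_lt_iff_minors_eq_zero {a b t : ℕ} (N : Matrix (Fin a) (Fin b) k) :
    N.rank < t ↔ ∀ (r : Fin t ↪o Fin a) (c : Fin t ↪o Fin b), (N.submatrix r c).det = 0 := by
  constructor
  · intro h r c
    by_contra hdet
    have h1 := rank_of_det_ne_zero hdet
    have h2 := rank_submatrix_le N r c
    rw [Fintype.card_fin] at h1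
    omega
  · intro h
    by_contra! hle
    obtain ⟨c, hc⟩ := exists_orderEmb_linearIndependent_col N hle
    have hrank : (N.submatrix id c)ᵀ.rank = t := by
      simpa using LinearIndependent.rank_matrix (M := (N.submatrix id c)ᵀ) hc
    obtain ⟨r, hr⟩ := exists_orderEmb_linearIndependent_col (t := t) (N.submatrix id c)ᵀ hrank.ge
    have hli : LinearIndependent k (N.submatrix r c).row := hr
    have := (linearIndependent_rows_iff_isUnit).1 hli
    rw [isUnit_iff_isUnit_det] at this
    exact this.ne_zero (h r c)

/-- Projecting the kernel of the block matrix to the second coordinates lands in `ker c`, and what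
is killed by the projection embeds in `ker a`. Rank-nullity turns this bound on the kernel into the
claim. -/
theorem rank_add_rank_le_rank_fromBlocks {l m n o : Type*} [Fintype l] [Fintype m] [Fintype n]
    [Fintype o] (a : Matrix m l k) (b : Matrix m n k) (c : Matrix o n k) :
    a.rank + c.rank ≤ (fromBlocks a b 0 c).rank := by
  have key := (fromBlocks a b 0 c).mulVecLin.finrank_range_add_finrank_ker
  have ha := a.mulVecLin.finrank_range_add_finrank_ker
  have hc := c.mulVecLin.finrank_range_add_finrank_ker
  let K := LinearMap.ker (fromBlocks a b 0 c).mulVecLin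
  let π : K →ₗ[k] (n → k) := (LinearMap.funLeft k k Sum.inr).comp K.subtype
  have hπ := π.finrank_range_add_finrank_ker
  have h1 : Module.finrank k (LinearMap.range π) ≤ Module.finrank k (LinearMap.ker c.mulVecLin) := by
    apply Submodule.finrank_mono
    rintro _ ⟨⟨x, hx⟩, rfl⟩
    have hx' : fromBlocks a b 0 c *ᵥ x = 0 := hx
    rw [fromBlocks_mulVec] at hx'
    rw [LinearMap.mem_ker]
    ext i
    have := congrFun hx' (Sum.inr i)
    simp only [Sum.elim_inr, zero_mulVec, Pi.zero_apply, zero_add] at this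
    exact this
  have h2 : Module.finrank k (LinearMap.ker π) ≤ Module.finrank k (LinearMap.ker a.mulVecLin) := by
    have hmem : ∀ x : LinearMap.ker π,
        (LinearMap.funLeft k k Sum.inl) x.1.1 ∈ LinearMap.ker a.mulVecLin := by
      rintro ⟨⟨x, hx⟩, hx0⟩
      have hx' : fromBlocks a b 0 c *ᵥ x = 0 := hx
      have hx0' : x ∘ Sum.inr = 0 := hx0
      rw [fromBlocks_mulVec, hx0'] at hx'
      rw [LinearMap.mem_ker]
      ext i
      have := congrFun hx' (Sum.inl i)
      simp only [Sum.elim_inl, mulVec_zero, Pi.zero_apply, add_zero] at this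
      exact this
    refine LinearMap.finrank_le_finrank_of_injective
      (f := LinearMap.codRestrict _
        ((LinearMap.funLeft k k Sum.inl).comp (K.subtype.comp (LinearMap.ker π).subtype)) hmem) ?_
    rintro ⟨⟨x, hx⟩, hx0⟩ ⟨⟨y, hy⟩, hy0⟩ hxy
    have hx0' : x ∘ Sum.inr = 0 := hx0
    have hy0' : y ∘ Sum.inr = 0 := hy0
    have hxy' : x ∘ Sum.inl = y ∘ Sum.inl := congrArg Subtype.val hxy
    ext j
    rcases j with j | j
    · exact congrFun hxy' j
    · exact (congrFun hx0' j).trans (congrFun hy0' j).symm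
  simp only [Module.finrank_fintype_fun_eq_card, Fintype.card_sum] at key ha hc
  unfold Matrix.rank
  change _ + Module.finrank k K = _ at key
  omega

end Rank

/-! ### Resolutions with entries in a fixed space `V`, shared by `A`, its quotient and their
opposites. -/

section ColumnResolution

variable {k A V : Type*} [Field k] [Ring A] [Algebra k A] [AddCommGroup V] [Module k V]

/-- A linear free resolution of the right module `A / I`, the entries of whose matrices are the
images of elements of a vector space `V` under `ι : V → A`. -/
structure ColumnResolution (ι : V →ₗ[k] A) (I : Submodule k A) where
  /-- the index set of the basis of the `i`-th free module -/
  J : ℕ → Type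
  [fintype : ∀ i, Fintype (J i)]
  [decEq : ∀ i, DecidableEq (J i)]
  /-- the matrices of the differentials -/
  d : ∀ i, Matrix (J i) (J (i + 1)) V
  card_zero : Fintype.card (J 0) = 1
  exact_zero : ∀ x : J 0 → A, (∃ y, (d 0).map ι *ᵥ y = x) ↔ ∀ j, x j ∈ I
  exact : ∀ i (x : J (i + 1) → A),
    (d i).map ι *ᵥ x = 0 ↔ ∃ y, (d (i + 1)).map ι *ᵥ y = x

attribute [instance] ColumnResolution.fintype ColumnResolution.decEq

/-- The pair `(q, p)` of functionals annihilates all quadratic relations between the `ι v`. -/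
def RelationZero (ι : V →ₗ[k] A) (q p : Module.Dual k V) : Prop :=
  ∀ (n : ℕ) (v w : Fin n → V), ∑ i, ι (v i) * ι (w i) = 0 → ∑ i, q (v i) * p (w i) = 0

theorem RelationZero.sum_eq_zero {ι : V →ₗ[k] A} {q p : Module.Dual k V} (h : RelationZero ι q p)
    {T : Type*} [Fintype T] (v w : T → V) (hvw : ∑ i, ι (v i) * ι (w i) = 0) :
    ∑ i, q (v i) * p (w i) = 0 := by
  let e := Fintype.equivFin T
  have := h (Fintype.card T) (v ∘ e.symm) (w ∘ e.symm) (by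
    rw [← hvw]; exact Equiv.sum_comp e.symm (fun i => ι (v i) * ι (w i)))
  rw [← this]
  exact (Equiv.sum_comp e.symm (fun i => q (v i) * p (w i))).symm

theorem relationZero_op {ι : V →ₗ[k] A} {q p : Module.Dual k V} :
    RelationZero ((MulOpposite.opLinearEquiv k).toLinearMap ∘ₗ ι) q p ↔ RelationZero ι p q := by
  constructor <;> intro h n v w hvw <;> have := h n w v
  · simp only [mul_comm (p _)]
    refine this ?_
    simp only [LinearMap.comp_apply, LinearEquiv.coe_coe, MulOpposite.coe_opLinearEquiv,
      ← MulOpposite.op_mul, ← Finset.op_sum, hvw, MulOpposite.op_zero]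
  · simp only [mul_comm (q _)]
    refine this ?_
    simp only [LinearMap.comp_apply, LinearEquiv.coe_coe, MulOpposite.coe_opLinearEquiv,
      ← MulOpposite.op_mul, ← Finset.op_sum] at hvw
    exact MulOpposite.op_injective hvw

/-- The beginning of a resolution is the one of a graded algebra with `A₁ = V`: the entries of the
first matrix form a basis of `V`, and the columns of the second one span the relations. -/
structure ColumnResolution.HasLinearPart {ι : V →ₗ[k] A} {I : Submodule k A}
    (P : ColumnResolution ι I) : Prop where
  linearIndependent : ∀ i, LinearIndependent k (P.d 0 i)
  span_eq_top : ∀ i, Submodule.span k (Set.range (P.d 0 i)) = ⊤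
  exists_relation : ∀ y : P.J 1 → V, (P.d 0).map ι *ᵥ (ι ∘ y) = 0 →
    ∃ c : P.J 2 → k, ∀ j, y j = ∑ l, c l • P.d 1 j l

theorem ColumnResolution.map_mul_map {ι : V →ₗ[k] A} {I : Submodule k A}
    (P : ColumnResolution ι I) (i : ℕ) : (P.d i).map ι * (P.d (i + 1)).map ι = 0 := by
  ext a b
  have := (P.exact i _).2 ⟨Pi.single b 1, rfl⟩
  rw [mulVec_mulVec] at this
  simpa using congrFun this a

end ColumnResolution

/-! ### Linear solutions and the start of a resolution over a connected graded algebra. -/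

section Graded

variable {k A V : Type*} [Field k] [Ring A] [Algebra k A] [AddCommGroup V] [Module k V]
  (𝒜 : ℕ → Submodule k A)

/-- `ι` identifies `V` with the component `A₁` of a graded algebra. -/
structure IsDegreeOnePart (ι : V →ₗ[k] A) : Prop where
  injective : Function.Injective ι
  range_eq : LinearMap.range ι = 𝒜 1

variable {𝒜} {ι : V →ₗ[k] A}

theorem IsDegreeOnePart.mem (hι : IsDegreeOnePart 𝒜 ι) (v : V) : ι v ∈ 𝒜 1 := by
  rw [← hι.range_eq]; exact ⟨v, rfl⟩

theorem IsDegreeOnePart.exists_eq (hι : IsDegreeOnePart 𝒜 ι) {a : A} (ha : a ∈ 𝒜 1) :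
    ∃ v, ι v = a := by
  rwa [← hι.range_eq] at ha

variable [GradedAlgebra 𝒜]

/-- Left multiplication by degree one elements shifts degrees by one, so a sum homogeneous of degree
`1 + i` sees only the degree `i` components of the coefficients. -/
theorem sum_mul_decompose (hι : IsDegreeOnePart 𝒜 ι) {T : Type*} [Fintype T] (v : T → V)
    (y : T → A) (i : ℕ) (h : ∑ j, ι (v j) * y j ∈ 𝒜 (1 + i)) :
    ∑ j, ι (v j) * (decompose 𝒜 (y j) i : A) = ∑ j, ι (v j) * y j := by
  have h1 := decompose_of_mem_same 𝒜 h
  rw [← h1, ← GradedRing.proj_apply, map_sum]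
  refine Finset.sum_congr rfl fun j _ => ?_
  rw [GradedRing.proj_apply, coe_decompose_mul_add_of_left_mem 𝒜 (hι.mem (v j))]

/-- A linear system whose right hand side is quadratic has a linear solution if it has one. -/
theorem exists_linear_solution (hι : IsDegreeOnePart 𝒜 ι) {m n o : Type*} [Fintype n]
    (M : Matrix m n V) (Z : Matrix m o A) (hZ : ∀ i j, Z i j ∈ 𝒜 2)
    (h : ∀ j, ∃ y, M.map ι *ᵥ y = Z.col j) :
    ∃ Y : Matrix n o V, M.map ι * Y.map ι = Z := by
  choose y hy using h
  have hc : ∀ a : A, ∃ v, ι v = (decompose 𝒜 a 1 : A) := fun a => hι.exists_eq (SetLike.coe_mem _)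
  choose c hc using hc
  refine ⟨Matrix.of fun j l => c (y l j), ?_⟩
  ext i l
  have h1 : ∑ j, ι (M i j) * y l j = Z i l := congrFun (hy l) i
  rw [← h1, ← sum_mul_decompose hι (M i) (y l) 1 (by rw [h1]; exact hZ i l)]
  simp [Matrix.mul_apply, hc]

variable (𝒜) in
theorem decompose_zero_of_mem_augmentation {a : A} (ha : a ∈ augmentation 𝒜) :
    (decompose 𝒜 a 0 : A) = 0 := by
  have : augmentation 𝒜 ≤ LinearMap.ker (GradedAlgebra.proj 𝒜 0) := by
    refine iSup_le fun i x hx => ?_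
    rw [LinearMap.mem_ker, GradedAlgebra.proj_apply]
    exact decompose_of_mem_ne 𝒜 hx (by omega)
  exact this ha

theorem mem_augmentation_mul (hι : IsDegreeOnePart 𝒜 ι) (v : V) (a : A) :
    ι v * a ∈ augmentation 𝒜 := by
  classical
  rw [← sum_support_decompose 𝒜 a, Finset.mul_sum]
  refine Submodule.sum_mem _ fun i _ => ?_
  refine (le_iSup (fun i => 𝒜 (i + 1)) i) ?_
  rw [add_comm]
  exact SetLike.mul_mem_graded (hι.mem v) (SetLike.coe_mem _)

/-- Exactness is read in the lowest degree. A scalar vector killed by `d 0` lies in the image of `d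
1`, so its entries are in the augmentation and vanish. Degree zero components of preimages under `d
0` and `d 1` supply the scalar coefficients for the other two properties. -/
theorem hasLinearPart (hconn : IsConnectedGraded 𝒜) (hι : IsDegreeOnePart 𝒜 ι)
    (P : ColumnResolution ι (augmentation 𝒜)) : P.HasLinearPart := by
  have hsub : Subsingleton (P.J 0) := Fintype.card_le_one_iff_subsingleton.1 P.card_zero.le
  have hc : ∀ a : A, ∃ c : k, algebraMap k A c = (decompose 𝒜 a 0 : A) := fun a => by
    exact hconn.2.le (SetLike.coe_mem (decompose 𝒜 a 0))
  choose c hc using hc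
  refine ⟨fun i => ?_, fun i => ?_, fun y hy => ?_⟩
  · rw [Fintype.linearIndependent_iff]
    intro g hg j
    have h0 : (P.d 0).map ι *ᵥ (fun j => algebraMap k A (g j)) = 0 := by
      ext i'
      obtain rfl : i' = i := Subsingleton.elim _ _
      have := congrArg ι hg
      simpa [Matrix.mulVec, dotProduct, ← Algebra.commutes, Algebra.smul_def] using this
    obtain ⟨y, hy⟩ := (P.exact 0 _).1 h0
    have hmem : algebraMap k A (g j) ∈ augmentation 𝒜 := by
      rw [← congrFun hy j]
      exact Submodule.sum_mem _ fun l _ => mem_augmentation_mul hι _ _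
    have h2 := decompose_zero_of_mem_augmentation 𝒜 hmem
    rw [decompose_of_mem_same 𝒜 (by rw [hconn.2]; exact ⟨g j, rfl⟩)] at h2
    exact hconn.1 (h2.trans (map_zero _).symm)
  · rw [eq_top_iff]
    rintro v -
    obtain ⟨y, hy⟩ := (P.exact_zero (fun _ => ι v)).2 fun _ =>
      (le_iSup (fun i => 𝒜 (i + 1)) 0) (hι.mem v)
    have h1 : ∑ j, ι (P.d 0 i j) * y j = ι v := congrFun hy i
    have h2 := sum_mul_decompose hι (P.d 0 i) y 0 (by rw [h1]; exact hι.mem v)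
    rw [h1] at h2
    have h3 : v = ∑ j, c (y j) • P.d 0 i j := by
      apply hι.injective
      rw [← h2, map_sum]
      refine Finset.sum_congr rfl fun j _ => ?_
      rw [map_smul, Algebra.smul_def, hc, ← hc, Algebra.commutes]
    rw [h3]
    exact Submodule.sum_mem _ fun j _ => Submodule.smul_mem _ _ (Submodule.subset_span ⟨j, rfl⟩)
  · obtain ⟨z, hz⟩ := (P.exact 0 _).1 hy
    refine ⟨fun l => c (z l), fun j => ?_⟩
    have h1 : ∑ l, ι (P.d 1 j l) * z l = ι (y j) := congrFun hz j
    have h2 := sum_mul_decompose hι (P.d 1 j) z 0 (by rw [h1]; exact hι.mem _)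
    apply hι.injective
    rw [← h1, ← h2, map_sum]
    refine Finset.sum_congr rfl fun l _ => ?_
    rw [map_smul, Algebra.smul_def, hc, ← hc, Algebra.commutes]

end Graded

/-! ### The twist by a regular normal element. -/

section Twist

variable {k A V : Type*} [Field k] [Ring A] [Algebra k A] [AddCommGroup V] [Module k V]

theorem IsNormalElement.exists_mul_eq {f : A} (h : IsNormalElement f) (a : A) :
    ∃ b, a * f = f * b := by
  have : a * f ∈ Set.range (fun a : A => f * a) := h ▸ ⟨a, rfl⟩
  obtain ⟨b, hb⟩ := this
  exact ⟨b, hb.symm⟩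

theorem IsNormalElement.exists_eq_mul {f : A} (h : IsNormalElement f) (a : A) :
    ∃ b, f * a = b * f := by
  have : f * a ∈ Set.range (fun a : A => a * f) := h.symm ▸ ⟨a, rfl⟩
  obtain ⟨b, hb⟩ := this
  exact ⟨b, hb.symm⟩

/-- The graded automorphism `τ` of `A` with `a f = f τ(a)` for a regular normal element `f`. -/
structure NormalTwist (ι : V →ₗ[k] A) (f : A) where
  /-- the endomorphism `τ` -/
  τ : A →ₐ[k] A
  /-- the restriction of `τ` to `V` -/
  t : V →ₗ[k] V
  mul_eq : ∀ a, a * f = f * τ a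
  map_self : τ f = f
  map_apply : ∀ v, τ (ι v) = ι (t v)
  surjective : Function.Surjective t

/-- Left cancellation of `f` makes `τ` well defined, multiplicative and degree preserving in degree
one. Right cancellation makes it injective on `V`, hence surjective by finite dimension. -/
theorem exists_normalTwist {𝒜 : ℕ → Submodule k A} [GradedAlgebra 𝒜] [FiniteDimensional k V]
    {ι : V →ₗ[k] A} (hι : IsDegreeOnePart 𝒜 ι) {f : A} (hf : f ∈ 𝒜 2) (hreg : IsRegular f)
    (hnormal : IsNormalElement f) : Nonempty (NormalTwist ι f) := by
  choose τ hτ using hnormal.exists_mul_eq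
  have hcancel : ∀ {a b : A}, f * a = f * b → a = b := fun h => hreg.left h
  let T : A →ₐ[k] A :=
    { toFun := τ
      map_one' := hcancel (by rw [← hτ, one_mul, mul_one])
      map_mul' := fun a b => hcancel (by rw [← hτ, mul_assoc, hτ b, ← mul_assoc, hτ a, mul_assoc])
      map_zero' := hcancel (by rw [← hτ, zero_mul, mul_zero])
      map_add' := fun a b => hcancel (by rw [← hτ, add_mul, hτ, hτ, mul_add])
      commutes' := fun c => hcancel (by rw [← hτ, Algebra.commutes]) }
  have hmem : ∀ v : V, ∃ w, ι w = τ (ι v) := fun v => by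
    refine hι.exists_eq ?_
    have h1 : f * τ (ι v) ∈ 𝒜 (2 + 1) := by
      rw [← hτ]; exact SetLike.mul_mem_graded (i := 1) (j := 2) (hι.mem v) hf
    have h2 := coe_decompose_mul_add_of_left_mem 𝒜 (j := 1) (b := τ (ι v)) hf
    rw [decompose_of_mem_same 𝒜 h1] at h2
    rw [hcancel h2]
    exact SetLike.coe_mem _
  choose t ht using hmem
  let t' : V →ₗ[k] V :=
    { toFun := t
      map_add' := fun v w => hι.injective (by
        rw [map_add, ht, ht, ht, map_add]; exact map_add T _ _)
      map_smul' := fun c v => hι.injective (by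
        rw [map_smul, ht, ht, map_smul]; exact map_smul T _ _) }
  refine ⟨⟨T, t', hτ, hcancel (hτ f).symm, fun v => (ht v).symm, ?_⟩⟩
  refine LinearMap.injective_iff_surjective.1 fun v w hvw => hι.injective (hreg.right ?_)
  have : ι (t v) = ι (t w) := congrArg ι hvw
  change ι v * f = ι w * f
  rw [hτ, hτ, ← ht, ← ht, this]

theorem NormalTwist.mul_smul {ι : V →ₗ[k] A} {f : A} (N : NormalTwist ι f) {l m n : Type*}
    [Fintype m] (X : Matrix l m A) (Y : Matrix m n A) : X * (f • Y) = f • (X.map N.τ * Y) := by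
  ext i j
  simp only [Matrix.mul_apply, Matrix.smul_apply, smul_eq_mul, Finset.mul_sum, Matrix.map_apply]
  exact Finset.sum_congr rfl fun a _ => by rw [← mul_assoc, N.mul_eq, mul_assoc]

theorem NormalTwist.map_map {ι : V →ₗ[k] A} {f : A} (N : NormalTwist ι f) {l m : Type*}
    (X : Matrix l m V) : (X.map ι).map N.τ = (X.map N.t).map ι := by
  ext i j
  exact N.map_apply _

end Twist

/-! ### Differentials and homotopies for the resolution over the quotient. -/

section Shamash

variable {k A V : Type*} [Field k] [Ring A] [Algebra k A] [AddCommGroup V] [Module k V]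

/-- Index sets of the free modules in the resolution over `A / (f)`, shifted by two:
`K (m + 2)` is the disjoint union of `J m` and `K m`. -/
def shamashIndex (J : ℕ → Type) : ℕ → Type
  | 0 => Empty
  | 1 => Empty
  | m + 2 => J m ⊕ shamashIndex J m

instance shamashFintype (J : ℕ → Type) [∀ i, Fintype (J i)] : ∀ m, Fintype (shamashIndex J m)
  | 0 => inferInstanceAs (Fintype Empty)
  | 1 => inferInstanceAs (Fintype Empty)
  | m + 2 =>
    haveI := shamashFintype J m
    inferInstanceAs (Fintype (J m ⊕ shamashIndex J m))

instance shamashDecEq (J : ℕ → Type) [∀ i, DecidableEq (J i)] :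
    ∀ m, DecidableEq (shamashIndex J m)
  | 0 => inferInstanceAs (DecidableEq Empty)
  | 1 => inferInstanceAs (DecidableEq Empty)
  | m + 2 =>
    haveI := shamashDecEq J m
    inferInstanceAs (DecidableEq (J m ⊕ shamashIndex J m))

/-- A matrix `Y` over `V` with `M Y = Z`, if there is one. -/
noncomputable def linearSolution (ι : V →ₗ[k] A) {m n o : Type*} [Fintype n] (M : Matrix m n V)
    (Z : Matrix m o A) : Matrix n o V :=
  open Classical in if h : ∃ Y : Matrix n o V, M.map ι * Y.map ι = Z then h.choose else 0

theorem map_mul_linearSolution {ι : V →ₗ[k] A} {m n o : Type*} [Fintype n] {M : Matrix m n V}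
    {Z : Matrix m o A} (h : ∃ Y : Matrix n o V, M.map ι * Y.map ι = Z) :
    M.map ι * (linearSolution ι M Z).map ι = Z := by
  rw [linearSolution, dif_pos h]
  exact h.choose_spec

/-- The right hand side of the equation for the next homotopy. -/
def homotopyRhs {J₀ K₀ K₁ : Type*} [Fintype K₁] [DecidableEq J₀] (f : A) (σ : Matrix J₀ K₁ A)
    (D : Matrix K₁ (J₀ ⊕ K₀) A) : Matrix J₀ (J₀ ⊕ K₀) A :=
  fromCols (f • (1 : Matrix J₀ J₀ A)) 0 - σ * D

variable {ι : V →ₗ[k] A} {I : Submodule k A} (P : ColumnResolution ι I) {f : A}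
  (N : NormalTwist ι f)

/-- Two consecutive differentials of the resolution over `A / (f)`, and the homotopy that enters
the next one. -/
structure ShamashState (m : ℕ) where
  /-- the differential from index `m + 1` to index `m` -/
  D₀ : Matrix (shamashIndex P.J m) (shamashIndex P.J (m + 1)) V
  /-- the differential from index `m + 2` to index `m + 1` -/
  D₁ : Matrix (shamashIndex P.J (m + 1)) (shamashIndex P.J (m + 2)) V
  /-- the homotopy -/
  σ : Matrix (P.J m) (shamashIndex P.J (m + 1)) V

/-- The differentials and homotopies over `A / (f)`, by recursion. -/
noncomputable def shamashState : ∀ m, ShamashState P m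
  -- Each of these matrices has an empty index set, so zero is the only choice.
  | 0 => ⟨0, 0, 0⟩
  | m + 1 =>
    let S := shamashState m
    ⟨S.D₁, fromBlocks (P.d m) S.σ 0 (S.D₀.map N.t),
      linearSolution ι (P.d m) (homotopyRhs f (S.σ.map ι) ((S.D₁.map N.t).map ι))⟩

/-- The differential `D m` of the resolution over `A / (f)`, in the shifted indexing. -/
noncomputable def shamashD (m : ℕ) :
    Matrix (shamashIndex P.J m) (shamashIndex P.J (m + 1)) V :=
  (shamashState P N m).D₀

/-- The homotopies for multiplication by `f`. -/
noncomputable def shamashσ (m : ℕ) : Matrix (P.J m) (shamashIndex P.J (m + 1)) V :=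
  (shamashState P N m).σ

section Blocks

variable {J₀ J₁ J₂ K₀ K₁ : Type*} [Fintype J₁] [Fintype K₁]

theorem twist_mul_twist [DecidableEq K₀] {D₀ : Matrix K₀ K₁ V} {D₁ : Matrix K₁ (J₀ ⊕ K₀) V}
    (hD : D₀.map ι * D₁.map ι = fromCols 0 (f • (1 : Matrix K₀ K₀ A))) :
    (D₀.map N.t).map ι * (D₁.map N.t).map ι = fromCols 0 (f • (1 : Matrix K₀ K₀ A)) := by
  have : ((D₀.map ι).map N.τ) * ((D₁.map ι).map N.τ) =
      (fromCols 0 (f • (1 : Matrix K₀ K₀ A)) : Matrix K₀ (J₀ ⊕ K₀) A).map N.τ := by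
    rw [← hD]; exact (Matrix.map_mul (f := N.τ.toRingHom)).symm
  rw [← N.map_map, ← N.map_map, this]
  ext i j
  rcases j with j | j
  · simp
  · by_cases hij : i = j
    · simp [hij, N.map_self]
    · simp [Matrix.one_apply_ne hij]

/-- The homotopy identity provides `f` in the upper rows, and the twisted earlier product provides
it in the lower rows, because `τ` fixes `f`. -/
theorem fromBlocks_mul_eq_fromCols [DecidableEq J₀] [DecidableEq K₀] {d₀ : Matrix J₀ J₁ V} {d₁ : Matrix J₁ J₂ V}
    {σ₀ : Matrix J₀ K₁ V} {σ₁ : Matrix J₁ (J₀ ⊕ K₀) V} {D₀ : Matrix K₀ K₁ V}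
    {D₁ : Matrix K₁ (J₀ ⊕ K₀) V} (hd : d₀.map ι * d₁.map ι = 0)
    (hσ : d₀.map ι * σ₁.map ι + σ₀.map ι * (D₁.map N.t).map ι =
      fromCols (f • (1 : Matrix J₀ J₀ A)) 0)
    (hD : D₀.map ι * D₁.map ι = fromCols 0 (f • (1 : Matrix K₀ K₀ A))) :
    (fromBlocks d₀ σ₀ 0 (D₀.map N.t)).map ι * (fromBlocks d₁ σ₁ 0 (D₁.map N.t)).map ι =
      fromCols 0 (f • (1 : Matrix (J₀ ⊕ K₀) (J₀ ⊕ K₀) A)) := by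
  rw [fromBlocks_map, fromBlocks_map, Matrix.map_zero _ (map_zero ι),
    Matrix.map_zero _ (map_zero ι), fromBlocks_multiply, hσ, hd]
  simp only [Matrix.mul_zero, add_zero, Matrix.zero_mul, zero_add, twist_mul_twist N hD]
  ext i j
  rcases i with i | i <;> rcases j with j | j | j <;> simp [Matrix.one_apply]

/-- This is the obstruction to the next homotopy: once it vanishes, exactness over `A` yields a
solution. Moving `f` past `d₀` and `σ₀` twists them, and the resulting terms cancel against the top
row of the twisted block matrix. -/
theorem mul_homotopyRhs_eq_zero [Fintype J₀] [Fintype K₀] [DecidableEq J₀] [DecidableEq J₁]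
    [DecidableEq K₁] {d₀ : Matrix J₀ J₁ V} {σ₀ : Matrix J₀ K₁ V}
    {σ₁ : Matrix J₁ (J₀ ⊕ K₀) V} {D₀ : Matrix K₀ K₁ V} {D₁ : Matrix K₁ (J₀ ⊕ K₀) V}
    (hσ : d₀.map ι * σ₁.map ι + σ₀.map ι * (D₁.map N.t).map ι =
      fromCols (f • (1 : Matrix J₀ J₀ A)) 0)
    (hD : D₁.map ι * (fromBlocks d₀ σ₀ 0 (D₀.map N.t)).map ι =
      fromCols 0 (f • (1 : Matrix K₁ K₁ A))) :
    d₀.map ι * homotopyRhs f (σ₁.map ι)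
      (((fromBlocks d₀ σ₀ 0 (D₀.map N.t)).map N.t).map ι) = 0 := by
  rw [homotopyRhs, Matrix.mul_sub, mul_fromCols, N.mul_smul, Matrix.mul_one, ← Matrix.mul_assoc,
    eq_sub_of_add_eq hσ, Matrix.sub_mul, Matrix.mul_assoc, twist_mul_twist N hD, mul_fromCols,
    N.mul_smul, Matrix.mul_one, N.map_map, N.map_map, fromBlocks_map, fromBlocks_map,
    fromCols_mul_fromBlocks]
  ext i j
  rcases j with j | j <;> simp

theorem homotopyRhs_mem [DecidableEq J₀] {𝒜 : ℕ → Submodule k A} [GradedAlgebra 𝒜] (hι : IsDegreeOnePart 𝒜 ι)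
    (hf : f ∈ 𝒜 2) (σ : Matrix J₀ K₁ V) (D : Matrix K₁ (J₀ ⊕ K₀) V) (i : J₀) (j : J₀ ⊕ K₀) :
    homotopyRhs f (σ.map ι) (D.map ι) i j ∈ 𝒜 2 := by
  refine Submodule.sub_mem _ ?_ (Submodule.sum_mem _ fun l _ =>
    SetLike.mul_mem_graded (i := 1) (j := 1) (hι.mem _) (hι.mem _))
  rcases j with j | j
  · by_cases hij : i = j
    · simpa [hij] using hf
    · simp [Matrix.one_apply_ne hij]
  · simp

theorem add_eq_of_mul_eq_homotopyRhs [DecidableEq J₀] {X : Matrix J₀ (J₀ ⊕ K₀) A} {σ : Matrix J₀ K₁ A}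
    {D : Matrix K₁ (J₀ ⊕ K₀) A} (h : X = homotopyRhs f σ D) :
    X + σ * D = fromCols (f • (1 : Matrix J₀ J₀ A)) 0 := by
  rw [h, homotopyRhs, sub_add_cancel]

end Blocks

theorem shamash_invariants {𝒜 : ℕ → Submodule k A} [GradedAlgebra 𝒜]
    (hι : IsDegreeOnePart 𝒜 ι) (hf : f ∈ 𝒜 2) (P : ColumnResolution ι (augmentation 𝒜)) (m : ℕ) :
    ((shamashD P N m).map ι * (shamashD P N (m + 1)).map ι =
      fromCols (0 : Matrix _ (P.J m) A) (f • (1 : Matrix (shamashIndex P.J m) _ A))) ∧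
    ((shamashD P N (m + 1)).map ι * (shamashD P N (m + 2)).map ι =
      fromCols (0 : Matrix _ (P.J (m + 1)) A)
        (f • (1 : Matrix (shamashIndex P.J (m + 1)) _ A))) ∧
    (P.d m).map ι * (shamashσ P N (m + 1)).map ι +
      (shamashσ P N m).map ι * ((shamashD P N (m + 1)).map N.t).map ι =
      fromCols (f • (1 : Matrix (P.J m) _ A)) (0 : Matrix _ (shamashIndex P.J m) A) := by
  induction m with
  | zero =>
    refine ⟨by ext i; exact i.elim, by ext i; exact i.elim, ?_⟩
    -- At the start the only obstruction is membership in the augmentation, which holds because the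
    -- right hand side has degree two.
    have hmem := homotopyRhs_mem hι hf (shamashσ P N 0) ((shamashD P N 1).map N.t)
    refine add_eq_of_mul_eq_homotopyRhs (map_mul_linearSolution
      (exists_linear_solution hι _ _ hmem fun j => ?_))
    exact (P.exact_zero _).2 fun i => (le_iSup (fun i => 𝒜 (i + 1)) 1) (hmem i j)
  | succ m ih =>
    obtain ⟨h1, h2, h3⟩ := ih
    refine ⟨h2, fromBlocks_mul_eq_fromCols N (P.map_mul_map m) h3 h1, ?_⟩
    have hmem := homotopyRhs_mem hι hf (shamashσ P N (m + 1)) ((shamashD P N (m + 2)).map N.t)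
    refine add_eq_of_mul_eq_homotopyRhs (map_mul_linearSolution
      (exists_linear_solution hι _ _ hmem fun j => (P.exact m _).1 ?_))
    have := mul_homotopyRhs_eq_zero N h3 h2
    ext i
    exact congrFun (congrFun this i) j

end Shamash

/-! ### Points and the first two matrices. -/

section LinearPart

variable {k A V : Type*} [Field k] [Ring A] [Algebra k A] [AddCommGroup V] [Module k V]
  {ι : V →ₗ[k] A} {I : Submodule k A} {P : ColumnResolution ι I}

theorem RelationZero.sum_eq_sum {q p : Module.Dual k V} (h : RelationZero ι q p) {S T : Type*}
    [Fintype S] [Fintype T] (v w : S → V) (v' w' : T → V)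
    (hvw : ∑ i, ι (v i) * ι (w i) = ∑ i, ι (v' i) * ι (w' i)) :
    ∑ i, q (v i) * p (w i) = ∑ i, q (v' i) * p (w' i) := by
  have := h.sum_eq_zero (Sum.elim v (fun i => -v' i)) (Sum.elim w w') (by
    simp [Fintype.sum_sum_type, hvw])
  simpa [Fintype.sum_sum_type, ← sub_eq_add_neg, sub_eq_zero] using this

theorem ColumnResolution.subsingleton_zero (P : ColumnResolution ι I) : Subsingleton (P.J 0) :=
  Fintype.card_le_one_iff_subsingleton.1 P.card_zero.le

theorem ColumnResolution.nonempty_zero (P : ColumnResolution ι I) : Nonempty (P.J 0) :=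
  Fintype.card_pos_iff.1 (by rw [P.card_zero]; exact one_pos)

theorem ColumnResolution.HasLinearPart.exists_apply_ne_zero (hP : P.HasLinearPart)
    {p : Module.Dual k V} (hp : p ≠ 0) (i : P.J 0) : ∃ j, p (P.d 0 i j) ≠ 0 := by
  by_contra! h
  refine hp (LinearMap.ext_on_range (hP.span_eq_top i) fun j => ?_)
  rw [h j, LinearMap.zero_apply]

theorem ColumnResolution.HasLinearPart.rank_zero (hP : P.HasLinearPart)
    {p : Module.Dual k V} (hp : p ≠ 0) : ((P.d 0).map p).rank = 1 := by
  refine le_antisymm ((rank_le_card_height _).trans P.card_zero.le) ?_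
  obtain ⟨i⟩ := P.nonempty_zero
  obtain ⟨j, hj⟩ := hP.exists_apply_ne_zero hp i
  have h1 := rank_submatrix_le ((P.d 0).map p) (fun _ : Unit => i) (fun _ : Unit => j)
  rwa [rank_of_det_ne_zero (by simpa using hj), Fintype.card_unit] at h1

/-- The entries of `d 0` are a basis of `V` and the columns of `d 1` span the relations, so it
suffices to test the relations given by these columns. -/
theorem ColumnResolution.HasLinearPart.relationZero_iff (hP : P.HasLinearPart)
    {q p : Module.Dual k V} :
    RelationZero ι q p ↔ (P.d 0).map q * (P.d 1).map p = 0 := by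
  constructor
  · intro h
    ext i l
    have := congrFun (congrFun (P.map_mul_map 0) i) l
    exact h.sum_eq_zero _ _ this
  · intro h n v w hvw
    obtain ⟨i⟩ := P.nonempty_zero
    have hsub := P.subsingleton_zero
    have hc : ∀ t, ∃ c : P.J 1 → k, ∑ j, c j • P.d 0 i j = v t := fun t =>
      Submodule.mem_span_range_iff_exists_fun k |>.1 (hP.span_eq_top i ▸ Submodule.mem_top)
    choose c hc using hc
    obtain ⟨e, he⟩ := hP.exists_relation (fun j => ∑ t, c t j • w t) (by
      ext i'
      obtain rfl := Subsingleton.elim i i'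
      rw [Pi.zero_apply, ← hvw]
      simp only [Matrix.mulVec, dotProduct, Matrix.map_apply, Function.comp_apply, map_sum,
        map_smul, ← hc, Finset.mul_sum, Finset.sum_mul]
      rw [Finset.sum_comm]
      simp)
    calc ∑ t, q (v t) * p (w t) = ∑ j, q (P.d 0 i j) * p (∑ t, c t j • w t) := by
          simp only [← hc, map_sum, map_smul, smul_eq_mul, Finset.mul_sum, Finset.sum_mul]
          rw [Finset.sum_comm]
          exact Finset.sum_congr rfl fun _ _ => Finset.sum_congr rfl fun _ _ => by ring
      _ = ∑ l, e l * ∑ j, q (P.d 0 i j) * p (P.d 1 j l) := by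
          simp only [he, map_sum, map_smul, smul_eq_mul, Finset.mul_sum]
          rw [Finset.sum_comm]
          exact Finset.sum_congr rfl fun _ _ => Finset.sum_congr rfl fun _ _ => by ring
      _ = 0 := Finset.sum_eq_zero fun l _ => by
          rw [show ∑ j, q (P.d 0 i j) * p (P.d 1 j l) = 0 from congrFun (congrFun h i) l, mul_zero]

/-- A linear dependence between the rows of `d 1` at `p` is a vector of values on the basis `d 0` of
`V`, that is, a functional `q` preceding `p`. -/
theorem ColumnResolution.HasLinearPart.rank_lt_iff (hP : P.HasLinearPart)
    {p : Module.Dual k V} :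
    ((P.d 1).map p).rank < Fintype.card (P.J 1) ↔ ∃ q ≠ 0, RelationZero ι q p := by
  obtain ⟨i⟩ := P.nonempty_zero
  have hsub := P.subsingleton_zero
  constructor
  · intro h
    have hdep : ¬ LinearIndependent k ((P.d 1).map p).row := fun hli =>
      h.ne hli.rank_matrix
    rw [Fintype.linearIndependent_iff] at hdep
    push Not at hdep
    obtain ⟨g, hg, j, hj⟩ := hdep
    let b := Module.Basis.mk (hP.linearIndependent i) (hP.span_eq_top i).ge
    have hb : ∀ j, (b.constr k g : Module.Dual k V) (P.d 0 i j) = g j := fun j => by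
      have := b.constr_basis k g j
      rwa [Module.Basis.mk_apply] at this
    refine ⟨b.constr k g, fun h0 => hj ?_, hP.relationZero_iff.2 ?_⟩
    · rw [← hb, h0, LinearMap.zero_apply]
    · ext i' l
      obtain rfl := Subsingleton.elim i i'
      have := congrFun hg l
      simpa [Matrix.mul_apply, hb] using this
  · rintro ⟨q, hq, hqp⟩
    have h1 := rank_add_rank_le_card_of_mul_eq_zero (hP.relationZero_iff.1 hqp)
    rw [hP.rank_zero hq, add_comm] at h1
    exact h1

theorem ColumnResolution.HasLinearPart.finrank_eq (hP : P.HasLinearPart) :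
    Module.finrank k V = Fintype.card (P.J 1) := by
  obtain ⟨i⟩ := P.nonempty_zero
  exact Module.finrank_eq_card_basis
    (Module.Basis.mk (hP.linearIndependent i) (hP.span_eq_top i).ge)

end LinearPart

/-! ### Successive points over the quotient by `f`. -/

section Quotient

variable {k A B V : Type*} [Field k] [Ring A] [Algebra k A] [Ring B] [Algebra k B]
  [AddCommGroup V] [Module k V]

/-- `π` is the projection onto the quotient by the ideal `f A`. -/
structure IsQuotientBy (π : A →ₐ[k] B) (f : A) : Prop where
  surjective : Function.Surjective π
  eq_zero_iff : ∀ a, π a = 0 ↔ ∃ b, a = f * b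

variable {π : A →ₐ[k] B} {f : A}

theorem IsQuotientBy.map_self (hπ : IsQuotientBy π f) : π f = 0 :=
  (hπ.eq_zero_iff f).2 ⟨1, (mul_one f).symm⟩

theorem RelationZero.of_quotient {ι : V →ₗ[k] A} {q p : Module.Dual k V}
    (h : RelationZero (π.toLinearMap ∘ₗ ι) q p) : RelationZero ι q p :=
  fun n v w hvw => h n v w (by simpa using congrArg π hvw)

variable {𝒜 : ℕ → Submodule k A} [GradedAlgebra 𝒜] {ι : V →ₗ[k] A}

theorem IsQuotientBy.exists_eq_smul (hconn : IsConnectedGraded 𝒜) (hf : f ∈ 𝒜 2)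
    (hπ : IsQuotientBy π f) {a : A} (ha : a ∈ 𝒜 2) (h : π a = 0) : ∃ c : k, a = c • f := by
  obtain ⟨b, rfl⟩ := (hπ.eq_zero_iff a).1 h
  have h1 := coe_decompose_mul_add_of_left_mem 𝒜 (j := 0) (b := b) hf
  rw [add_zero, decompose_of_mem_same 𝒜 ha] at h1
  obtain ⟨c, hc⟩ := hconn.2.le (SetLike.coe_mem (decompose 𝒜 b 0))
  refine ⟨c, ?_⟩
  rw [h1, ← hc, Algebra.linearMap_apply, ← Algebra.commutes, Algebra.smul_def]

/-- In degree two the ideal `fA` is the line spanned by `f`, so the quotient has just one additional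
quadratic condition. -/
theorem relationZero_quotient_iff (hconn : IsConnectedGraded 𝒜) (hι : IsDegreeOnePart 𝒜 ι)
    (hf : f ∈ 𝒜 2) (hπ : IsQuotientBy π f) {T : Type*} [Fintype T] {x y : T → V}
    (hxy : ∑ j, ι (x j) * ι (y j) = f) {q p : Module.Dual k V} :
    RelationZero (π.toLinearMap ∘ₗ ι) q p ↔
      RelationZero ι q p ∧ ∑ j, q (x j) * p (y j) = 0 := by
  constructor
  · intro h
    refine ⟨h.of_quotient, h.sum_eq_zero x y ?_⟩
    have := congrArg π hxy
    rw [hπ.map_self] at this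
    simpa using this
  · rintro ⟨h, h0⟩ n v w hvw
    have hmem : ∑ i, ι (v i) * ι (w i) ∈ 𝒜 2 := Submodule.sum_mem _ fun i _ =>
      SetLike.mul_mem_graded (i := 1) (j := 1) (hι.mem _) (hι.mem _)
    obtain ⟨c, hc⟩ := hπ.exists_eq_smul hconn hf hmem (by simpa using hvw)
    rw [h.sum_eq_sum v w (fun j => c • x j) y (by
      rw [hc, ← hxy, Finset.smul_sum]
      simp)]
    simp [mul_assoc, ← Finset.mul_sum, h0]

theorem exists_quadratic_lift (hι : IsDegreeOnePart 𝒜 ι) (hf : f ∈ 𝒜 2)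
    (P : ColumnResolution ι (augmentation 𝒜)) (i : P.J 0) :
    ∃ y : P.J 1 → V, ∑ j, ι (P.d 0 i j) * ι (y j) = f := by
  have hsub := P.subsingleton_zero
  obtain ⟨Y, hY⟩ := exists_linear_solution hι (P.d 0) (Matrix.of fun _ (_ : Unit) => f)
    (fun _ _ => hf) fun _ => (P.exact_zero _).2 fun _ => (le_iSup (fun i => 𝒜 (i + 1)) 1) hf
  exact ⟨fun j => Y j (), congrFun (congrFun hY i) ()⟩

/-- If `r`, `q`, `p` are successive points, then `f(q, p) = 0` if and only if `f(r, q) = 0`. -/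
theorem relationZero_quotient_chain (hconn : IsConnectedGraded 𝒜) (hι : IsDegreeOnePart 𝒜 ι)
    (hf : f ∈ 𝒜 2) (hπ : IsQuotientBy π f) (N : NormalTwist ι f)
    (P : ColumnResolution ι (augmentation 𝒜)) {r q p : Module.Dual k V} (hr : r ≠ 0) (hp : p ≠ 0)
    (hrq : RelationZero ι r q) (hqp : RelationZero ι q p) :
    RelationZero (π.toLinearMap ∘ₗ ι) q p ↔ RelationZero (π.toLinearMap ∘ₗ ι) r q := by
  obtain ⟨i₀⟩ := P.nonempty_zero
  have hsub := P.subsingleton_zero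
  have hP := hasLinearPart hconn hι P
  obtain ⟨y, hy⟩ := exists_quadratic_lift hι hf P i₀
  rw [relationZero_quotient_iff hconn hι hf hπ hy, relationZero_quotient_iff hconn hι hf hπ hy]
  simp only [hrq, hqp, true_and]
  -- With `x` the row of `d 0` and `f = ∑ x_j y_j`, the matrix `f δ_{ji} - y_j τ(x_i)` is killed by
  -- `x`, since `x_i f = f τ(x_i)`. Hence it factors through `d 1`.
  obtain ⟨Z, hZ⟩ := exists_linear_solution hι (P.d 1)
    (Matrix.of fun j i => (if j = i then f else 0) - ι (y j) * ι (N.t (P.d 0 i₀ i)))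
    (fun j i => Submodule.sub_mem _ (by split_ifs <;> simp [hf])
      (SetLike.mul_mem_graded (i := 1) (j := 1) (hι.mem _) (hι.mem _)))
    fun i => (P.exact 0 _).1 (by
      ext i'
      obtain rfl := Subsingleton.elim i₀ i'
      simp only [Matrix.mulVec, dotProduct, Matrix.map_apply, Matrix.col_apply, Matrix.of_apply,
        mul_sub, Finset.sum_sub_distrib, ← mul_assoc, ← Finset.sum_mul, hy, Pi.zero_apply]
      simp [N.mul_eq, N.map_apply])
  have key : ∀ j i, ∑ l, q (P.d 1 j l) * p (Z l i) + q (y j) * p (N.t (P.d 0 i₀ i)) =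
      if j = i then ∑ a, q (P.d 0 i₀ a) * p (y a) else 0 := by
    intro j i
    have h1 : ∑ l, ι (P.d 1 j l) * ι (Z l i) =
        (if j = i then f else 0) - ι (y j) * ι (N.t (P.d 0 i₀ i)) := congrFun (congrFun hZ j) i
    have h2 := hqp.sum_eq_sum (Sum.elim (P.d 1 j) (fun _ : Unit => y j))
      (Sum.elim (fun l => Z l i) (fun _ : Unit => N.t (P.d 0 i₀ i)))
      (fun a => if j = i then P.d 0 i₀ a else 0) y (by
        simp only [Fintype.sum_sum_type, Sum.elim_inl, Sum.elim_inr, h1]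
        by_cases hij : j = i
        · simp [hij, hy]
        · simp [hij])
    by_cases hij : j = i
    · simpa [Fintype.sum_sum_type, hij] using h2
    · simpa [Fintype.sum_sum_type, hij] using h2
  -- Evaluating the factorization at `(q, p)` and contracting with `r` removes the `d 1` term,
  -- leaving `f(r, q) p(τ x_i) = r(x_i) f(q, p)`.
  have main : ∀ i, (∑ j, r (P.d 0 i₀ j) * q (y j)) * p (N.t (P.d 0 i₀ i)) =
      r (P.d 0 i₀ i) * ∑ a, q (P.d 0 i₀ a) * p (y a) := by
    intro i
    have h1 : ∑ j, r (P.d 0 i₀ j) * ∑ l, q (P.d 1 j l) * p (Z l i) = 0 := by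
      simp only [Finset.mul_sum, ← mul_assoc]
      rw [Finset.sum_comm]
      refine Finset.sum_eq_zero fun l _ => ?_
      rw [← Finset.sum_mul, show ∑ j, r (P.d 0 i₀ j) * q (P.d 1 j l) = 0 from
        congrFun (congrFun (hP.relationZero_iff.1 hrq) i₀) l, zero_mul]
    have h2 : ∑ j, r (P.d 0 i₀ j) * (∑ l, q (P.d 1 j l) * p (Z l i) +
        q (y j) * p (N.t (P.d 0 i₀ i))) = r (P.d 0 i₀ i) * ∑ a, q (P.d 0 i₀ a) * p (y a) := by
      simp only [key]
      simp
    simp only [mul_add, Finset.sum_add_distrib, h1, zero_add, ← mul_assoc, ← Finset.sum_mul] at h2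
    exact h2
  constructor
  · intro h
    have hpt : p ∘ₗ N.t ≠ 0 := fun h0 => hp (by
      ext v
      obtain ⟨w, rfl⟩ := N.surjective v
      exact LinearMap.congr_fun h0 w)
    obtain ⟨i, hi⟩ := hP.exists_apply_ne_zero hpt i₀
    have := main i
    rw [h, mul_zero] at this
    exact (mul_eq_zero.1 this).resolve_right hi
  · intro h
    obtain ⟨i, hi⟩ := hP.exists_apply_ne_zero hr i₀
    have := main i
    rw [h, zero_mul] at this
    exact (mul_eq_zero.1 this.symm).resolve_left hi

/-- Since `τ` fixes `f`, it preserves `fA` and hence the relations of the quotient. -/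
theorem relationZero_twist (hπ : IsQuotientBy π f) (N : NormalTwist ι f) {q p : Module.Dual k V}
    (h : RelationZero (π.toLinearMap ∘ₗ ι) q p) :
    RelationZero (π.toLinearMap ∘ₗ ι) (q ∘ₗ N.t) (p ∘ₗ N.t) := by
  intro n v w hvw
  refine h n (fun i => N.t (v i)) (fun i => N.t (w i)) ?_
  obtain ⟨b, hb⟩ := (hπ.eq_zero_iff (∑ i, ι (v i) * ι (w i))).1 (by simpa using hvw)
  have h1 : ∑ i, ι (N.t (v i)) * ι (N.t (w i)) = f * N.τ b := by
    have := congrArg N.τ hb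
    rw [map_mul, N.map_self] at this
    simpa [N.map_apply] using this
  have h2 := (hπ.eq_zero_iff _).2 ⟨_, h1⟩
  simpa using h2

end Quotient

/-! ### Exactness and ranks of the resolution over the quotient. -/

section ShamashResolution

variable {k A B V : Type*} [Field k] [Ring A] [Algebra k A] [Ring B] [Algebra k B]
  [AddCommGroup V] [Module k V]

instance shamashIndex_isEmpty_zero (J : ℕ → Type) : IsEmpty (shamashIndex J 0) :=
  inferInstanceAs (IsEmpty Empty)

instance shamashIndex_isEmpty_one (J : ℕ → Type) : IsEmpty (shamashIndex J 1) :=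
  inferInstanceAs (IsEmpty Empty)

theorem NormalTwist.mulVec_smul {ι : V →ₗ[k] A} {f : A} (N : NormalTwist ι f) {l m : Type*}
    [Fintype m] (X : Matrix l m V) (w : m → A) :
    X.map ι *ᵥ (f • w) = f • ((X.map N.t).map ι *ᵥ w) := by
  ext i
  simp only [Matrix.mulVec, dotProduct, Pi.smul_apply, smul_eq_mul, Finset.mul_sum,
    Matrix.map_apply]
  exact Finset.sum_congr rfl fun a _ => by rw [← mul_assoc, N.mul_eq, N.map_apply, mul_assoc]

theorem fromCols_zero_smul_one_mulVec {J K : Type*} [Fintype J] [Fintype K] [DecidableEq K]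
    (f : A) (x : J ⊕ K → A) :
    fromCols (0 : Matrix K J A) (f • (1 : Matrix K K A)) *ᵥ x = f • (x ∘ Sum.inr) := by
  rw [fromCols_mulVec]
  ext i
  simp [Matrix.smul_mulVec]

/-- A vector that is a cycle modulo `f` is already a boundary over `A`: the quotient `w` of its
image by `f` serves as the lower part of a preimage. -/
theorem exists_fromBlocks_mulVec_eq {ι : V →ₗ[k] A} {f : A} (hreg : IsRegular f)
    (N : NormalTwist ι f) {J₀ J₁ J₂ K₀ K₁ : Type*} [Fintype J₀] [Fintype J₁] [Fintype J₂]
    [Fintype K₀] [Fintype K₁] [DecidableEq J₀] [DecidableEq K₀] [DecidableEq K₁]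
    {d₀ : Matrix J₀ J₁ V} {d₁ : Matrix J₁ J₂ V} {σ₀ : Matrix J₀ K₁ V} {σ₁ : Matrix J₁ (J₀ ⊕ K₀) V}
    {D₀ : Matrix K₀ K₁ V} {D₁ : Matrix K₁ (J₀ ⊕ K₀) V}
    (hexact : ∀ u, d₀.map ι *ᵥ u = 0 → ∃ t, d₁.map ι *ᵥ t = u)
    (h₁ : D₁.map ι * (fromBlocks d₀ σ₀ 0 (D₀.map N.t)).map ι =
      fromCols 0 (f • (1 : Matrix K₁ K₁ A)))
    (h₂ : (fromBlocks d₀ σ₀ 0 (D₀.map N.t)).map ι * (fromBlocks d₁ σ₁ 0 (D₁.map N.t)).map ι =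
      fromCols 0 (f • (1 : Matrix (J₀ ⊕ K₀) (J₀ ⊕ K₀) A)))
    {x : J₁ ⊕ K₁ → A} {w : J₀ ⊕ K₀ → A}
    (hx : (fromBlocks d₀ σ₀ 0 (D₀.map N.t)).map ι *ᵥ x = f • w) :
    ∃ y, (fromBlocks d₁ σ₁ 0 (D₁.map N.t)).map ι *ᵥ y = x := by
  have hcol : ∀ t : J₂ → A, (fromBlocks d₁ σ₁ 0 (D₁.map N.t)).map ι *ᵥ Sum.elim t w =
      Sum.elim (d₁.map ι *ᵥ t + σ₁.map ι *ᵥ w) ((D₁.map N.t).map ι *ᵥ w) := fun t => by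
    rw [fromBlocks_map, fromBlocks_mulVec, Matrix.map_zero _ (map_zero ι)]
    simp
  -- Applying the preceding differential `D₁` to `hx` gives `f` times the lower part of `x` on one
  -- side and `f τ(D₁) w` on the other.
  have hinr : x ∘ Sum.inr = (D₁.map N.t).map ι *ᵥ w := by
    have h3 : f • (x ∘ Sum.inr) = f • ((D₁.map N.t).map ι *ᵥ w) := by
      rw [← fromCols_zero_smul_one_mulVec, ← h₁, ← mulVec_mulVec, hx, N.mulVec_smul]
    ext i
    exact hreg.left (congrFun h3 i)
  -- Subtracting the image of `(0, w)` leaves a genuine cycle with zero lower part, to which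
  -- exactness over `A` applies.
  have hsub : (fromBlocks d₀ σ₀ 0 (D₀.map N.t)).map ι *ᵥ
      (x - Sum.elim (σ₁.map ι *ᵥ w) ((D₁.map N.t).map ι *ᵥ w)) = 0 := by
    have h3 := hcol 0
    rw [mulVec_zero, zero_add] at h3
    rw [mulVec_sub, ← h3, mulVec_mulVec, h₂, fromCols_zero_smul_one_mulVec, hx,
      Sum.elim_comp_inr, sub_self]
  obtain ⟨t, ht⟩ := hexact (x ∘ Sum.inl - σ₁.map ι *ᵥ w) (by
    have h3 : x - Sum.elim (σ₁.map ι *ᵥ w) ((D₁.map N.t).map ι *ᵥ w) =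
        Sum.elim (x ∘ Sum.inl - σ₁.map ι *ᵥ w) 0 := by
      ext i
      rcases i with i | i
      · rfl
      · exact sub_eq_zero.2 (congrFun hinr i)
    rw [h3, fromBlocks_map, fromBlocks_mulVec] at hsub
    ext i
    have := congrFun hsub (Sum.inl i)
    simpa using this)
  refine ⟨Sum.elim t w, ?_⟩
  rw [hcol, ht, ← hinr, sub_add_cancel, Sum.elim_comp_inl_inr]

theorem fromBlocks_mulVec_of_isEmpty {J₀ J₁ K₀ K₁ : Type*} [Fintype J₀] [Fintype J₁] [Fintype K₁]
    [IsEmpty K₀] [IsEmpty K₁] (ι : V →ₗ[k] A) (d : Matrix J₀ J₁ V) (σ : Matrix J₀ K₁ V)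
    (D : Matrix K₀ K₁ V) (y : J₁ ⊕ K₁ → A) :
    (fromBlocks d σ 0 D).map ι *ᵥ y = Sum.elim (d.map ι *ᵥ (y ∘ Sum.inl)) isEmptyElim := by
  rw [fromBlocks_map, fromBlocks_mulVec]
  ext i
  rcases i with i | i
  · simp [Matrix.mulVec, dotProduct]
  · exact isEmptyElim i

variable {π : A →ₐ[k] B} {f : A}

theorem map_comp_mulVec (π : A →ₐ[k] B) (ι : V →ₗ[k] A) {m n : Type*} [Fintype n]
    (M : Matrix m n V) (x : n → A) :
    M.map (π.toLinearMap ∘ₗ ι) *ᵥ (π ∘ x) = π ∘ (M.map ι *ᵥ x) := by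
  ext i
  simp [Matrix.mulVec, dotProduct]

variable {𝒜 : ℕ → Submodule k A} {ι : V →ₗ[k] A}

section

variable [GradedAlgebra 𝒜]

/-- The linear free resolution over `A / (f)` built from one over `A` and homotopies for the
multiplication by `f`. -/
noncomputable def shamashResolution (hι : IsDegreeOnePart 𝒜 ι) (hf : f ∈ 𝒜 2)
    (hreg : IsRegular f) (N : NormalTwist ι f) (hπ : IsQuotientBy π f)
    (P : ColumnResolution ι (augmentation 𝒜)) :
    ColumnResolution (π.toLinearMap ∘ₗ ι) ((augmentation 𝒜).map π.toLinearMap) where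
  J i := shamashIndex P.J (i + 2)
  d i := shamashD P N (i + 2)
  card_zero := by
    have : Fintype.card (P.J 0 ⊕ shamashIndex P.J 0) = 1 := by
      rw [Fintype.card_sum, P.card_zero, Fintype.card_eq_zero]
    exact this
  exact_zero x := by
    have hcol : ∀ y : P.J 1 ⊕ shamashIndex P.J 1 → A, (shamashD P N 2).map ι *ᵥ y =
        Sum.elim ((P.d 0).map ι *ᵥ (y ∘ Sum.inl)) isEmptyElim :=
      fun y => fromBlocks_mulVec_of_isEmpty (K₀ := shamashIndex P.J 0) (K₁ := shamashIndex P.J 1)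
        _ _ _ _ _
    constructor
    · rintro ⟨y, rfl⟩ j
      obtain ⟨y, rfl⟩ := hπ.surjective.comp_left y
      rw [map_comp_mulVec]
      refine ⟨_, ?_, rfl⟩
      rcases j with j | j
      · exact (congrFun (hcol y) (Sum.inl j)) ▸ (P.exact_zero _).1 ⟨_, rfl⟩ j
      · exact isEmptyElim j
    · intro h
      choose a ha hax using h
      obtain ⟨y, hy⟩ := (P.exact_zero (fun j => a (Sum.inl j))).2 fun j => ha _
      refine ⟨π ∘ (Sum.elim y isEmptyElim : P.J 1 ⊕ shamashIndex P.J 1 → A), ?_⟩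
      refine (map_comp_mulVec π ι (shamashD P N 2) _).trans (funext fun j => ?_)
      rw [← hax j]
      refine congrArg π ((congrFun (hcol _) j).trans ?_)
      rcases j with j | j
      · exact congrFun hy j
      · exact isEmptyElim j
  exact i x := by
    obtain ⟨x, rfl⟩ := hπ.surjective.comp_left x
    obtain ⟨h1, h2, -⟩ := shamash_invariants N hι hf P (i + 1)
    constructor
    · intro h
      rw [map_comp_mulVec] at h
      have hw : ∀ j, ∃ b, ((shamashD P N (i + 2)).map ι *ᵥ x) j = f * b :=
        fun j => (hπ.eq_zero_iff _).1 (congrFun h j)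
      choose w hw using hw
      obtain ⟨y, hy⟩ := exists_fromBlocks_mulVec_eq hreg N (fun u => (P.exact i u).1) h1 h2
        (w := w) (funext hw)
      exact ⟨π ∘ y, (map_comp_mulVec π ι (shamashD P N (i + 3)) y).trans
        (congrArg (fun z => π ∘ z) hy)⟩
    · rintro ⟨y, hy⟩
      obtain ⟨y, rfl⟩ := hπ.surjective.comp_left y
      rw [← hy, map_comp_mulVec, map_comp_mulVec, mulVec_mulVec]
      funext j
      have h3 : ((shamashD P N (i + 2)).map ι * (shamashD P N (i + 3)).map ι) *ᵥ y =
          f • fun j => y (Sum.inr j) := by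
        rw [show (shamashD P N (i + 2)).map ι * (shamashD P N (i + 3)).map ι = _ from h2]
        exact fromCols_zero_smul_one_mulVec f y
      refine (congrArg π (congrFun h3 j)).trans ?_
      rw [Pi.smul_apply, smul_eq_mul, map_mul, hπ.map_self, zero_mul, Pi.zero_apply]

theorem fromBlocks_inl_comp {J₀ J₁ K₀ K₁ : Type*} [IsEmpty K₁] (d : Matrix J₀ J₁ V)
    (σ : Matrix J₀ K₁ V) (D : Matrix K₀ K₁ V) (i : J₀) :
    (fromBlocks d σ 0 D) (Sum.inl i) = d i ∘ Equiv.sumEmpty J₁ K₁ := by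
  ext j
  rcases j with j | j
  · rfl
  · exact isEmptyElim j

/-- A relation over the quotient lifts to `c • f`; subtracting `c` times the column of `σ` that
represents `f` leaves a relation over `A`. This direct argument needs no grading on `B`. -/
theorem shamashResolution_hasLinearPart (hconn : IsConnectedGraded 𝒜) (hι : IsDegreeOnePart 𝒜 ι)
    (hf : f ∈ 𝒜 2) (hreg : IsRegular f) (N : NormalTwist ι f) (hπ : IsQuotientBy π f)
    (P : ColumnResolution ι (augmentation 𝒜)) :
    (shamashResolution hι hf hreg N hπ P).HasLinearPart := by
  have hP := hasLinearPart hconn hι P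
  have hrow : ∀ i : P.J 0, shamashD P N 2 (Sum.inl i) =
      P.d 0 i ∘ Equiv.sumEmpty (P.J 1) (shamashIndex P.J 1) := fun i =>
    fromBlocks_inl_comp (K₀ := shamashIndex P.J 0) (K₁ := shamashIndex P.J 1) _ _ _ _
  refine ⟨?_, ?_, ?_⟩
  · rintro (i | i)
    · change LinearIndependent k (shamashD P N 2 (Sum.inl i))
      rw [hrow]
      exact (hP.linearIndependent i).comp _ (Equiv.injective _)
    · exact isEmptyElim i
  · rintro (i | i)
    · change Submodule.span k (Set.range (shamashD P N 2 (Sum.inl i))) = ⊤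
      rw [hrow]
      exact (congrArg (Submodule.span k) ((Equiv.surjective _).range_comp _)).trans (hP.span_eq_top i)
    · exact isEmptyElim i
  · intro y hy
    obtain ⟨i₀⟩ := P.nonempty_zero
    have hsub := P.subsingleton_zero
    have hfσ : ∑ j, ι (P.d 0 i₀ j) * ι (shamashσ P N 1 j (Sum.inl i₀)) = f := by
      have h3 := congrFun (congrFun (shamash_invariants N hι hf P 0).2.2 i₀) (Sum.inl i₀)
      have h4 : ((shamashσ P N 0).map ι * ((shamashD P N 1).map N.t).map ι) i₀ (Sum.inl i₀) = 0 :=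
        (Matrix.mul_apply ..).trans
          (Finset.sum_eq_zero fun (l : shamashIndex P.J 1) _ => isEmptyElim l)
      have h5 : ((P.d 0).map ι * (shamashσ P N 1).map ι) i₀ (Sum.inl i₀) +
        ((shamashσ P N 0).map ι * ((shamashD P N 1).map N.t).map ι) i₀ (Sum.inl i₀) = f :=
        h3.trans (by simp)
      rw [h4, add_zero] at h5
      exact h5
    have hker : π (∑ j, ι (P.d 0 i₀ j) * ι (y (Sum.inl j))) = 0 := by
      have h3 : ((shamashD P N 2).map (π.toLinearMap ∘ₗ ι) *ᵥ
        ((π.toLinearMap ∘ₗ ι) ∘ y)) (Sum.inl i₀) = 0 := congrFun hy (Sum.inl i₀)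
      have h4 := congrFun (fromBlocks_mulVec_of_isEmpty (K₀ := shamashIndex P.J 0)
        (K₁ := shamashIndex P.J 1) (π.toLinearMap ∘ₗ ι) (P.d 0)
        (shamashσ P N 0) ((shamashD P N 0).map N.t) ((π.toLinearMap ∘ₗ ι) ∘ y)) (Sum.inl i₀)
      have h5 : ∑ j, π (ι (P.d 0 i₀ j)) * π (ι (y (Sum.inl j))) = 0 := h4.symm.trans h3
      simpa using h5
    obtain ⟨c, hc⟩ := hπ.exists_eq_smul hconn hf (Submodule.sum_mem _ fun j _ =>
      SetLike.mul_mem_graded (i := 1) (j := 1) (hι.mem _) (hι.mem _)) hker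
    obtain ⟨e, he⟩ := hP.exists_relation
      (fun j => y (Sum.inl j) - c • shamashσ P N 1 j (Sum.inl i₀)) (by
        ext i
        obtain rfl := Subsingleton.elim i₀ i
        simp only [Matrix.mulVec, dotProduct, Matrix.map_apply, Function.comp_apply, map_sub,
          map_smul, mul_sub, Finset.sum_sub_distrib, hc, Pi.zero_apply, mul_smul_comm,
          ← Finset.smul_sum, hfσ, sub_self])
    refine ⟨(Sum.elim e (fun _ => c) : P.J 2 ⊕ (P.J 0 ⊕ shamashIndex P.J 0) → k), ?_⟩
    rintro (j | j)
    · refine Eq.trans ?_ (Fintype.sum_sum_type _).symm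
      have h6 : ∑ l : P.J 0 ⊕ shamashIndex P.J 0, c • shamashσ P N 1 j l =
          c • shamashσ P N 1 j (Sum.inl i₀) := by
        rw [Fintype.sum_sum_type, Fintype.sum_subsingleton _ i₀, Fintype.sum_empty, add_zero]
      rw [show y (Sum.inl j) = _ from eq_add_of_sub_eq (he j), ← h6]
      rfl
    · exact isEmptyElim j

end

/-- The ranks at the points of the differentials over `A / (f)`, from those over `A`. -/
def shamashRank (r : ℕ → ℕ) : ℕ → ℕ
  | 0 => 0
  | 1 => 0
  | m + 2 => r m + shamashRank r m

/-- Adding the identity over `A` at `m` to the one already obtained at `m` gives the one at `m + 2`.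
Hence the range reaches `ℓ + 1`, although the input stops below `ℓ`. -/
theorem shamashRank_add {I : Submodule k A} (P : ColumnResolution ι I) {r : ℕ → ℕ} {ℓ : ℕ}
    (hr₀ : r 0 = 1) (hr : ∀ j < ℓ, r j + r (j + 1) = Fintype.card (P.J (j + 1))) :
    ∀ m, m ≤ ℓ + 1 → shamashRank r m + shamashRank r (m + 1) =
      Fintype.card (shamashIndex P.J (m + 1))
  | 0, _ => (Fintype.card_eq_zero (α := shamashIndex P.J 1)).symm
  | 1, _ => by
    have : Fintype.card (P.J 0 ⊕ shamashIndex P.J 0) = 1 := by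
      rw [Fintype.card_sum, P.card_zero, Fintype.card_eq_zero]
    refine Eq.trans ?_ this.symm
    simp [shamashRank, hr₀]
  | m + 2, hm => by
    have h1 := shamashRank_add P hr₀ hr m (by omega)
    have h2 := hr m (by omega)
    have : Fintype.card (P.J (m + 1) ⊕ shamashIndex P.J (m + 1)) =
      (r m + r (m + 1)) + (shamashRank r m + shamashRank r (m + 1)) := by
      rw [Fintype.card_sum, h1, h2]
    refine Eq.trans ?_ this.symm
    simp only [shamashRank]
    omega

variable [GradedAlgebra 𝒜]

/-- Strong induction squeezes the rank. The lower bound uses the value at `m` at the twisted point,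
the upper bound the value at `m + 1` at a predecessor. They meet by `shamashRank_add`. -/
theorem rank_shamashD (hι : IsDegreeOnePart 𝒜 ι) (hf : f ∈ 𝒜 2)
    (N : NormalTwist ι f) (hπ : IsQuotientBy π f) (P : ColumnResolution ι (augmentation 𝒜))
    {Y : Set (Module.Dual k V)} {r : ℕ → ℕ} {ℓ : ℕ}
    (hrank : ∀ j ≤ ℓ, ∀ p ∈ Y, ((P.d j).map p).rank = r j) (hr₀ : r 0 = 1)
    (hr : ∀ j < ℓ, r j + r (j + 1) = Fintype.card (P.J (j + 1)))
    (hYt : ∀ p ∈ Y, p ∘ₗ N.t ∈ Y)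
    (hYq : ∀ p ∈ Y, ∃ q ∈ Y, RelationZero (π.toLinearMap ∘ₗ ι) q p) (m : ℕ) :
    m ≤ ℓ + 2 → ∀ p ∈ Y, ((shamashD P N m).map p).rank = shamashRank r m := by
  induction m using Nat.strong_induction_on with
  | _ m ih =>
  intro hm p hp
  match m, ih, hm with
  | 0, _, _ | 1, _, _ =>
    exact Nat.le_zero.1 ((rank_le_card_height _).trans Fintype.card_eq_zero.le)
  | m + 2, ih, hm =>
    obtain ⟨q, hq, hqp⟩ := hYq p hp
    have hcard := shamashRank_add P hr₀ hr (m + 1) (by omega)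
    have hlow : ((P.d m).map p).rank + (((shamashD P N m).map N.t).map p).rank ≤
        ((shamashD P N (m + 2)).map p).rank := by
      have := rank_add_rank_le_rank_fromBlocks ((P.d m).map p) ((shamashσ P N m).map p)
        (((shamashD P N m).map N.t).map p)
      rw [← Matrix.map_zero p (map_zero p), ← fromBlocks_map] at this
      exact this
    rw [hrank m (by omega) p hp, show ((shamashD P N m).map N.t).map p =
      (shamashD P N m).map (p ∘ₗ N.t) from rfl, ih m (by omega) (by omega) _ (hYt p hp)] at hlow
    -- Over `A` the product is `(0 | f)`, so its entries are relations over `B`, and these vanish at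
    -- `(q, p)`.
    have hzero : (shamashD P N (m + 1)).map q * (shamashD P N (m + 2)).map p = 0 := by
      ext i j
      refine hqp.sum_eq_zero (fun l => shamashD P N (m + 1) i l)
        (fun l => shamashD P N (m + 2) l j) ?_
      have h1 := congrFun (congrFun (shamash_invariants N hι hf P m).2.1 i) j
      have h2 : π (∑ l, ι (shamashD P N (m + 1) i l) * ι (shamashD P N (m + 2) l j)) = 0 := by
        refine (congrArg π h1).trans ?_
        rcases j with j | j
        · exact map_zero π
        · change π (f * _) = 0
          rw [map_mul, hπ.map_self, zero_mul]
      simpa using h2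
    have hup : _ ≤ Fintype.card (shamashIndex P.J (m + 2)) :=
      rank_add_rank_le_card_of_mul_eq_zero hzero
    rw [ih (m + 1) (by omega) (by omega) q hq] at hup
    have hdef : shamashRank r (m + 2) = r m + shamashRank r m := rfl
    have hcard' : shamashRank r (m + 1) + shamashRank r (m + 2) =
      Fintype.card (shamashIndex P.J (m + 2)) := hcard
    omega

/-- A linear free resolution over `A` yields one over `A / (f)`, with the inherited rank
conditions at the points. -/
theorem exists_quotient_resolution [FiniteDimensional k V] (hconn : IsConnectedGraded 𝒜)
    (hι : IsDegreeOnePart 𝒜 ι) (hf : f ∈ 𝒜 2) (hreg : IsRegular f) (hnormal : IsNormalElement f)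
    (hπ : IsQuotientBy π f) (P : ColumnResolution ι (augmentation 𝒜)) :
    ∃ Q : ColumnResolution (π.toLinearMap ∘ₗ ι) ((augmentation 𝒜).map π.toLinearMap),
      Q.HasLinearPart ∧ ∀ ℓ,
      (∀ j < ℓ, ∀ p ≠ 0, (∃ q ≠ 0, RelationZero ι q p) →
        ((P.d j).map p).rank + ((P.d (j + 1)).map p).rank = Fintype.card (P.J (j + 1))) →
      (∀ q ≠ 0, (∃ p ≠ 0, RelationZero ι q p) → ∃ r ≠ 0, RelationZero ι r q) →
      ∀ j < ℓ, ∀ p ≠ 0, (∃ q ≠ 0, RelationZero (π.toLinearMap ∘ₗ ι) q p) →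
        ((Q.d j).map p).rank + ((Q.d (j + 1)).map p).rank = Fintype.card (Q.J (j + 1)) := by
  obtain ⟨N⟩ := exists_normalTwist hι hf hreg hnormal
  refine ⟨shamashResolution hι hf hreg N hπ P,
    shamashResolution_hasLinearPart hconn hι hf hreg N hπ P, fun ℓ hrank hsemi j hj p hp hpq => ?_⟩
  have hP := hasLinearPart hconn hι P
  let Y : Set (Module.Dual k V) :=
    {p | p ≠ 0 ∧ ∃ q ≠ 0, RelationZero (π.toLinearMap ∘ₗ ι) q p}
  have hYA : ∀ p ∈ Y, ∃ q ≠ 0, RelationZero ι q p := fun p ⟨_, q, hq, h⟩ => ⟨q, hq, h.of_quotient⟩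
  -- The first rank is always one, and point-exactness then determines each subsequent rank.
  have hconst : ∀ i ≤ ℓ, ∀ p' ∈ Y, ((P.d i).map p').rank = ((P.d i).map p).rank := by
    intro i
    induction i with
    | zero => intro _ p' hp'; rw [hP.rank_zero hp'.1, hP.rank_zero hp]
    | succ i ih =>
      intro hi p' hp'
      have h1 := hrank i hi p' hp'.1 (hYA p' hp')
      have h2 := hrank i hi p hp (hYA p ⟨hp, hpq⟩)
      have h3 := ih (by omega) p' hp'
      omega
  have hr : ∀ i < ℓ, ((P.d i).map p).rank + ((P.d (i + 1)).map p).rank =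
      Fintype.card (P.J (i + 1)) := fun i hi => hrank i hi p hp (hYA p ⟨hp, hpq⟩)
  have ht : ∀ {p : Module.Dual k V}, p ≠ 0 → p ∘ₗ N.t ≠ 0 := fun {p} hp h0 => hp (by
    ext v
    obtain ⟨w, rfl⟩ := N.surjective v
    exact LinearMap.congr_fun h0 w)
  have key := rank_shamashD hι hf N hπ P (Y := Y) hconst (hP.rank_zero hp) hr
    (fun p ⟨hp, q, hq, h⟩ => ⟨ht hp, _, ht hq, relationZero_twist hπ N h⟩)
    -- The predecessor `q` must itself have a predecessor over `B`: symmetry gives some `r` over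
    -- `A`, and the chain lemma adds the condition `f(r, q) = 0`.
    (fun p ⟨hp, q, hq, h⟩ => by
      obtain ⟨r, hr, hrq⟩ := hsemi q hq ⟨p, hp, h.of_quotient⟩
      exact ⟨q, ⟨hq, r, hr, (relationZero_quotient_chain hconn hι hf hπ N P hr hp hrq
        h.of_quotient).1 h⟩, h⟩)
  have hcard := shamashRank_add P (r := fun i => ((P.d i).map p).rank) (hP.rank_zero hp) hr (j + 2)
    (by omega)
  change ((shamashD P N (j + 2)).map p).rank + ((shamashD P N (j + 3)).map p).rank = _
  rw [key (j + 2) (by omega) p ⟨hp, hpq⟩, key (j + 3) (by omega) p ⟨hp, hpq⟩]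
  exact hcard

end ShamashResolution

/-! ### Passage to the opposite algebra. -/

section Opposite

variable {k A B V : Type*} [Field k] [Ring A] [Algebra k A] [Ring B] [Algebra k B]
  [AddCommGroup V] [Module k V]

/-- The opposite of a grading. -/
def opGrading (𝒜 : ℕ → Submodule k A) (i : ℕ) : Submodule k Aᵐᵒᵖ :=
  (𝒜 i).map (opLinearEquiv k : A ≃ₗ[k] Aᵐᵒᵖ).toLinearMap

theorem op_mem_opGrading {𝒜 : ℕ → Submodule k A} {i : ℕ} {a : A} :
    op a ∈ opGrading 𝒜 i ↔ a ∈ 𝒜 i :=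
  Submodule.mem_map_equiv (𝒜 i) (e := (opLinearEquiv k : A ≃ₗ[k] Aᵐᵒᵖ))

noncomputable instance opGradedAlgebra (𝒜 : ℕ → Submodule k A) [GradedAlgebra 𝒜] :
    GradedAlgebra (opGrading 𝒜) := by
  have hint : IsInternal (opGrading 𝒜) := by
    have h := Decomposition.isInternal 𝒜
    rw [isInternal_submodule_iff_iSupIndep_and_iSup_eq_top] at h ⊢
    refine ⟨h.1.map_orderIso (Submodule.orderIsoMapComap (opLinearEquiv k : A ≃ₗ[k] Aᵐᵒᵖ)), ?_⟩
    refine (Submodule.map_iSup _ _).symm.trans ?_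
    rw [h.2, Submodule.map_top, LinearEquiv.range]
  exact
    { one_mem := op_mem_opGrading.2 SetLike.GradedOne.one_mem
      mul_mem := by
        rintro i j _ _ ⟨a, ha, rfl⟩ ⟨b, hb, rfl⟩
        exact op_mem_opGrading.2 (add_comm j i ▸ SetLike.mul_mem_graded hb ha)
      toDecomposition := hint.chooseDecomposition }

theorem isConnectedGraded_op {𝒜 : ℕ → Submodule k A} (h : IsConnectedGraded 𝒜) :
    IsConnectedGraded (opGrading 𝒜) := by
  refine ⟨fun a b hab => h.1 (op_injective hab), ?_⟩
  rw [opGrading, h.2]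
  ext x
  constructor
  · rintro ⟨_, ⟨c, rfl⟩, rfl⟩
    exact ⟨c, rfl⟩
  · rintro ⟨c, rfl⟩
    exact ⟨_, ⟨c, rfl⟩, rfl⟩

/-- The embedding of `V` into the opposite algebra. -/
def opMap (ι : V →ₗ[k] A) : V →ₗ[k] Aᵐᵒᵖ :=
  (opLinearEquiv k : A ≃ₗ[k] Aᵐᵒᵖ).toLinearMap ∘ₗ ι

theorem IsDegreeOnePart.op {𝒜 : ℕ → Submodule k A} {ι : V →ₗ[k] A} (h : IsDegreeOnePart 𝒜 ι) :
    IsDegreeOnePart (opGrading 𝒜) (opMap ι) :=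
  ⟨op_injective.comp h.injective, by rw [opMap, LinearMap.range_comp, h.range_eq]; rfl⟩

theorem mem_augmentation_op {𝒜 : ℕ → Submodule k A} {a : A} :
    op a ∈ augmentation (opGrading 𝒜) ↔ a ∈ augmentation 𝒜 := by
  have : augmentation (opGrading 𝒜) =
      (augmentation 𝒜).map (opLinearEquiv k : A ≃ₗ[k] Aᵐᵒᵖ).toLinearMap :=
    (Submodule.map_iSup _ _).symm
  rw [this]
  exact Submodule.mem_map_equiv _ (e := (opLinearEquiv k : A ≃ₗ[k] Aᵐᵒᵖ))

theorem isRegular_op {f : A} (h : IsRegular f) : IsRegular (op f) :=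
  ⟨fun _ _ hab => unop_injective (h.right (op_injective hab)),
    fun _ _ hab => unop_injective (h.left (op_injective hab))⟩

theorem isNormalElement_op {f : A} (h : IsNormalElement f) : IsNormalElement (op f) := by
  ext x
  constructor
  · rintro ⟨a, rfl⟩
    obtain ⟨b, hb⟩ := h.exists_eq_mul a.unop
    exact ⟨op b, unop_injective hb.symm⟩
  · rintro ⟨a, rfl⟩
    obtain ⟨b, hb⟩ := h.exists_mul_eq a.unop
    exact ⟨op b, unop_injective hb.symm⟩

/-- Normality identifies `fA` with `Af`, the ideal that appears on the opposite side. -/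
theorem IsQuotientBy.op {π : A →ₐ[k] B} {f : A} (hπ : IsQuotientBy π f)
    (hnormal : IsNormalElement f) : IsQuotientBy (AlgHom.op π) (op f) := by
  refine ⟨fun b => ?_, fun a => ?_⟩
  · obtain ⟨a, ha⟩ := hπ.surjective b.unop
    exact ⟨MulOpposite.op a, unop_injective ha⟩
  · have h1 : AlgHom.op π a = 0 ↔ π a.unop = 0 :=
      ⟨fun h => op_injective h, fun h => unop_injective h⟩
    rw [h1, hπ.eq_zero_iff]
    constructor
    · rintro ⟨b, hb⟩
      obtain ⟨c, hc⟩ := hnormal.exists_eq_mul b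
      exact ⟨MulOpposite.op c, unop_injective (hb.trans hc)⟩
    · rintro ⟨b, rfl⟩
      exact hnormal.exists_mul_eq b.unop

end Opposite

/-! ### Translation between column resolutions and left or right linear resolutions. -/

section Conversion

variable {k A V : Type*} [Field k] [Ring A] [Algebra k A] [AddCommGroup V] [Module k V]
  {𝒜 : ℕ → Submodule k A}

theorem op_comp_vecMul {m n : Type*} [Fintype m] (ι : V →ₗ[k] A) (M : Matrix m n V) (x : m → A) :
    (Mᵀ).map (opMap ι) *ᵥ (op ∘ x) = op ∘ ((M.map ι).vecMul x) := by
  ext j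
  simp [Matrix.mulVec, Matrix.vecMul, dotProduct, opMap, Finset.op_sum]

/-- A resolution of the right module `k_A`, as a `ColumnResolution`. -/
def RightLinearResolution.toColumn (P : RightLinearResolution 𝒜) :
    ColumnResolution (𝒜 1).subtype (augmentation 𝒜) where
  J i := Fin (P.s i)
  d := P.d
  card_zero := by rw [Fintype.card_fin, P.s_zero]
  exact_zero := P.exact_zero
  exact := P.exact

/-- A resolution of the left module `_A k`, as a `ColumnResolution` over the opposite algebra. -/
def LeftLinearResolution.toColumn (Q : LeftLinearResolution 𝒜) :
    ColumnResolution (opMap (𝒜 1).subtype) (augmentation (opGrading 𝒜)) where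
  J i := Fin (Q.s i)
  d i := (Q.h i)ᵀ
  card_zero := by rw [Fintype.card_fin, Q.s_zero]
  exact_zero x := by
    obtain ⟨x, rfl⟩ := op_surjective.comp_left x
    simp only [Function.comp_apply, mem_augmentation_op]
    refine Iff.trans ?_ (Q.exact_zero x)
    constructor
    · rintro ⟨y, hy⟩
      obtain ⟨y, rfl⟩ := op_surjective.comp_left y
      rw [op_comp_vecMul] at hy
      exact ⟨y, op_injective.comp_left hy⟩
    · rintro ⟨y, rfl⟩
      exact ⟨op ∘ y, op_comp_vecMul _ _ _⟩
  exact i x := by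
    obtain ⟨x, rfl⟩ := op_surjective.comp_left x
    rw [op_comp_vecMul]
    have h0 : op ∘ (((Q.h i).map (𝒜 1).subtype).vecMul x) = 0 ↔
        ((Q.h i).map (𝒜 1).subtype).vecMul x = 0 :=
      ⟨fun h => op_injective.comp_left (h.trans (by ext; rfl)), fun h => by rw [h]; ext; rfl⟩
    rw [h0]
    refine (Q.exact i x).trans ?_
    constructor
    · rintro ⟨y, rfl⟩
      exact ⟨op ∘ y, op_comp_vecMul _ _ _⟩
    · rintro ⟨y, hy⟩
      obtain ⟨y, rfl⟩ := op_surjective.comp_left y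
      rw [op_comp_vecMul] at hy
      exact ⟨y, op_injective.comp_left hy⟩

theorem submatrix_symm_mulVec_eq_iff {m n m' n' : Type*} [Fintype n] [Fintype n'] (M : Matrix m n A)
    (e₁ : m ≃ m') (e₂ : n ≃ n') (x : m' → A) (y : n' → A) :
    (M.submatrix e₁.symm e₂.symm) *ᵥ y = x ↔ M *ᵥ (y ∘ e₂) = x ∘ e₁ := by
  rw [submatrix_mulVec_equiv, Equiv.symm_symm]
  constructor
  · rintro rfl
    ext i
    simp
  · intro h
    rw [h]
    ext i
    simp

variable {ι : V →ₗ[k] A} {I : Submodule k A}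

/-- A `ColumnResolution`, as a resolution of the right module `k_A`. -/
noncomputable def ColumnResolution.toRight (Q : ColumnResolution ι I) (e : V ≃ₗ[k] 𝒜 1)
    (he : ∀ v, (e v : A) = ι v) (hI : ∀ a, a ∈ I ↔ a ∈ augmentation 𝒜) :
    RightLinearResolution 𝒜 where
  s i := Fintype.card (Q.J i)
  d i := ((Q.d i).map e).submatrix (Fintype.equivFin _).symm (Fintype.equivFin _).symm
  s_zero := Q.card_zero
  exact_zero x := by
    have hmap : ((Q.d 0).map e).map (fun a : 𝒜 1 => (a : A)) = (Q.d 0).map ι := by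
      ext i j; exact he _
    simp only [← submatrix_map, submatrix_symm_mulVec_eq_iff, hmap, ← hI]
    refine Iff.trans ?_ ((Q.exact_zero (x ∘ Fintype.equivFin _)).trans
      (Equiv.forall_congr_right (q := fun j => x j ∈ I) (Fintype.equivFin (Q.J 0))))
    exact ⟨fun ⟨y, hy⟩ => ⟨_, hy⟩, fun ⟨y, hy⟩ => ⟨y ∘ (Fintype.equivFin _).symm, by
        rw [← hy]; congr 1; ext; simp⟩⟩
  exact i x := by
    have hmap : ∀ i, ((Q.d i).map e).map (fun a : 𝒜 1 => (a : A)) = (Q.d i).map ι := fun i => by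
      ext _ _; exact he _
    simp only [← submatrix_map, submatrix_symm_mulVec_eq_iff, hmap]
    refine Iff.trans (Q.exact i (x ∘ Fintype.equivFin _)) ?_
    exact ⟨fun ⟨y, hy⟩ => ⟨y ∘ (Fintype.equivFin _).symm, by
        rw [← hy]; congr 1; ext; simp⟩, fun ⟨y, hy⟩ => ⟨_, hy⟩⟩

theorem submatrix_symm_vecMul_eq_iff (e : V ≃ₗ[k] 𝒜 1) (he : ∀ v, (e v : A) = ι v)
    {m n m' n' : Type*} [Fintype n] [Fintype n']
    (M : Matrix m n V) (e₁ : m ≃ m') (e₂ : n ≃ n') (x : m' → A) (y : n' → A) :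
    (((M.map e)ᵀ.submatrix e₂.symm e₁.symm).map (fun a : 𝒜 1 => (a : A))).vecMul y = x ↔
      M.map (opMap ι) *ᵥ (op ∘ y ∘ e₂) = op ∘ x ∘ e₁ := by
  have hmap : ((M.map e).map (opMap (𝒜 1).subtype)) = M.map (opMap ι) := by
    ext i j; exact congrArg op (he _)
  rw [← op_injective.comp_left.eq_iff]
  refine (Eq.congr_left (op_comp_vecMul (𝒜 1).subtype _ y).symm).trans ?_
  rw [transpose_submatrix, transpose_transpose, ← submatrix_map, submatrix_symm_mulVec_eq_iff, hmap]
  rfl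

/-- A `ColumnResolution` over the opposite algebra, as a resolution of the left module `_A k`. -/
noncomputable def ColumnResolution.toLeft {I : Submodule k Aᵐᵒᵖ}
    (Q : ColumnResolution (opMap ι) I) (e : V ≃ₗ[k] 𝒜 1)
    (he : ∀ v, (e v : A) = ι v) (hI : ∀ a, op a ∈ I ↔ a ∈ augmentation 𝒜) :
    LeftLinearResolution 𝒜 where
  s i := Fintype.card (Q.J i)
  h i := ((Q.d i).map e)ᵀ.submatrix (Fintype.equivFin _).symm (Fintype.equivFin _).symm
  s_zero := Q.card_zero
  exact_zero x := by
    simp only [submatrix_symm_vecMul_eq_iff e he, ← hI]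
    refine Iff.trans ?_ ((Q.exact_zero (op ∘ x ∘ Fintype.equivFin _)).trans
      (Equiv.forall_congr_right (q := fun j => op (x j) ∈ I) (Fintype.equivFin (Q.J 0))))
    exact ⟨fun ⟨y, hy⟩ => ⟨_, hy⟩, fun ⟨y, hy⟩ => ⟨unop ∘ y ∘ (Fintype.equivFin _).symm, by
        rw [← hy]; congr 1; ext; simp⟩⟩
  exact i x := by
    have h0 : (0 : Fin (Fintype.card (Q.J i)) → A) ∘ Fintype.equivFin (Q.J i) = 0 := rfl
    have h1 : op ∘ (0 : Q.J i → A) = 0 := by ext; rfl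
    simp only [submatrix_symm_vecMul_eq_iff e he, h0, h1]
    refine Iff.trans (Q.exact i (op ∘ x ∘ Fintype.equivFin _)) ?_
    exact ⟨fun ⟨y, hy⟩ => ⟨unop ∘ y ∘ (Fintype.equivFin _).symm, by
        rw [← hy]; congr 1; ext; simp⟩, fun ⟨y, hy⟩ => ⟨_, hy⟩⟩

end Conversion

/-! ### Determinantal loci as sets of points with a predecessor or successor. -/

section Points

variable {k A V W : Type*} [Field k] [Ring A] [Algebra k A] [AddCommGroup V] [Module k V]
  [AddCommGroup W] [Module k W] {ι : V →ₗ[k] A}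

theorem mem_minorLocus_iff {a b t : ℕ} {M : Matrix (Fin a) (Fin b) V}
    {p : ℙ k (Module.Dual k V)} : p ∈ minorLocus t M ↔ (evalMatrix M p).rank < t :=
  (rank_lt_iff_minors_eq_zero _).symm

theorem isProjectiveVariety_minorLocus {a b : ℕ} (t : ℕ) (M : Matrix (Fin a) (Fin b) V) :
    IsProjectiveVariety (k := k) (minorLocus t M) := by
  refine ⟨Set.range fun rc : (Fin t ↪o Fin a) × (Fin t ↪o Fin b) =>
    ((M.map (MvPolynomial.X (R := k))).submatrix rc.1 rc.2).det, ?_, ?_⟩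
  · rintro _ ⟨⟨r, c⟩, rfl⟩
    refine ⟨t, ?_⟩
    dsimp only
    rw [Matrix.det_apply]
    refine MvPolynomial.IsHomogeneous.sum _ _ _ fun τ _ => ?_
    refine (MvPolynomial.homogeneousSubmodule V k t).smul_of_tower_mem _ ?_
    have := MvPolynomial.IsHomogeneous.prod (R := k) Finset.univ
      (fun i => ((M.map (MvPolynomial.X (R := k))).submatrix r c) (τ i) i) (fun _ => 1)
      (fun i _ => MvPolynomial.isHomogeneous_X k _)
    simpa using this
  · ext p
    simp only [minorLocus, Set.mem_ofPred_eq, Set.forall_mem_range, Prod.forall]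
    refine forall₂_congr fun r c => ?_
    have : polyEval p ((M.map (MvPolynomial.X (R := k))).submatrix r c).det =
        ((evalMatrix M p).submatrix r c).det := by
      rw [polyEval, AlgHom.map_det]
      congr 1
      ext i j
      simp [evalMatrix]
    rw [this]

theorem RelationZero.smul {q p : Module.Dual k V} (h : RelationZero ι q p) (a b : k) :
    RelationZero ι (a • q) (b • p) := by
  intro n v w hvw
  have := h n v w hvw
  simp only [LinearMap.smul_apply, smul_eq_mul, mul_mul_mul_comm a, ← Finset.mul_sum, this,
    mul_zero]

theorem relationZero_units_smul {q p : Module.Dual k V} (a b : kˣ) :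
    RelationZero ι (a • q) (b • p) ↔ RelationZero ι q p :=
  ⟨fun h => by simpa [Units.smul_def, smul_smul] using h.smul (↑a⁻¹ : k) (↑b⁻¹ : k),
    fun h => h.smul (a : k) (b : k)⟩

theorem relationZero_comp_equiv (e : V ≃ₗ[k] W) {ι' : W →ₗ[k] A} (he : ∀ v, ι' (e v) = ι v)
    {q p : Module.Dual k W} :
    RelationZero ι (q ∘ₗ e.toLinearMap) (p ∘ₗ e.toLinearMap) ↔ RelationZero ι' q p := by
  constructor <;> intro h n v w hvw
  · simpa using h n (e.symm ∘ v) (e.symm ∘ w) (by simpa [← he] using hvw)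
  · exact h n (e ∘ v) (e ∘ w) (by simpa [he] using hvw)

theorem relationZero_mk_rep {q p : Module.Dual k V} (hq : q ≠ 0) (hp : p ≠ 0) :
    RelationZero ι (Projectivization.mk k q hq).rep (Projectivization.mk k p hp).rep ↔
      RelationZero ι q p := by
  obtain ⟨a, ha⟩ := Projectivization.exists_smul_eq_mk_rep k q hq
  obtain ⟨b, hb⟩ := Projectivization.exists_smul_eq_mk_rep k p hp
  rw [← ha, ← hb, relationZero_units_smul]

theorem rank_map_units_smul {m n : Type*} [Fintype n] (M : Matrix m n V) (p : Module.Dual k V)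
    (a : kˣ) : (M.map (a • p)).rank = (M.map p).rank := by
  rw [← rank_smul_of_mem_nonZeroDivisors (M.map p) (mem_nonZeroDivisors_of_ne_zero a.ne_zero)]
  rfl

theorem rank_map_mk_rep {m n : Type*} [Fintype n] (M : Matrix m n V) {p : Module.Dual k V}
    (hp : p ≠ 0) : (M.map (Projectivization.mk k p hp).rep).rank = (M.map p).rank := by
  obtain ⟨a, ha⟩ := Projectivization.exists_smul_eq_mk_rep k p hp
  rw [← ha, rank_map_units_smul]

theorem mem_bilinearZeros_iff {𝒜 : ℕ → Submodule k A} {q p : ℙ k (Module.Dual k (𝒜 1))} :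
    (q, p) ∈ bilinearZeros (relations 𝒜) ↔ RelationZero (𝒜 1).subtype q.rep p.rep := by
  constructor
  · intro h n v w hvw
    have := h (∑ i, v i ⊗ₜ[k] w i) (by
      rw [relations, LinearMap.mem_ker, map_sum, ← hvw]
      rfl)
    simpa using this
  · intro h g hg
    obtain ⟨S, rfl⟩ := TensorProduct.exists_finset g
    rw [relations, LinearMap.mem_ker, map_sum] at hg
    rw [map_sum, ← Finset.sum_coe_sort]
    rw [← Finset.sum_coe_sort] at hg
    exact h.sum_eq_zero (fun i : S => i.1.1) (fun i : S => i.1.2) hg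

/-- Every point that has a predecessor has a successor, and conversely. -/
def IsPointSymmetric (ι : V →ₗ[k] A) : Prop :=
  ∀ p ≠ 0, (∃ q ≠ 0, RelationZero ι q p) ↔ ∃ r ≠ 0, RelationZero ι p r

variable {𝒜 : ℕ → Submodule k A}

/-- The right side does not mention the resolution, so different resolutions can be used
interchangeably. -/
theorem RightLinearResolution.mem_X_iff (P : RightLinearResolution 𝒜)
    (hP : P.toColumn.HasLinearPart) {p : ℙ k (Module.Dual k (𝒜 1))} :
    p ∈ P.X ↔ ∃ q ≠ 0, RelationZero (𝒜 1).subtype q p.rep := by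
  rw [RightLinearResolution.X, mem_minorLocus_iff, hP.finrank_eq]
  exact hP.rank_lt_iff

theorem LeftLinearResolution.mem_X_iff (Q : LeftLinearResolution 𝒜)
    (hQ : Q.toColumn.HasLinearPart) {p : ℙ k (Module.Dual k (𝒜 1))} :
    p ∈ Q.X ↔ ∃ q ≠ 0, RelationZero (𝒜 1).subtype p.rep q := by
  rw [LeftLinearResolution.X, mem_minorLocus_iff, hQ.finrank_eq, ← rank_transpose]
  refine (hQ.rank_lt_iff (p := p.rep)).trans ?_
  simp only [opMap, relationZero_op]

theorem ColumnResolution.rank_evalMatrix_toRight {I : Submodule k A} (Q : ColumnResolution ι I)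
    (e : V ≃ₗ[k] 𝒜 1) (he : ∀ v, (e v : A) = ι v) (hI : ∀ a, a ∈ I ↔ a ∈ augmentation 𝒜) (i : ℕ)
    (p : ℙ k (Module.Dual k (𝒜 1))) :
    (evalMatrix ((Q.toRight e he hI).d i) p).rank =
      ((Q.d i).map (p.rep ∘ₗ e.toLinearMap)).rank :=
  rank_submatrix ((Q.d i).map (p.rep ∘ₗ e.toLinearMap)) _ _

theorem ColumnResolution.rank_evalMatrix_toLeft {I : Submodule k Aᵐᵒᵖ}
    (Q : ColumnResolution (opMap ι) I) (e : V ≃ₗ[k] 𝒜 1) (he : ∀ v, (e v : A) = ι v)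
    (hI : ∀ a, op a ∈ I ↔ a ∈ augmentation 𝒜) (i : ℕ) (p : ℙ k (Module.Dual k (𝒜 1))) :
    (evalMatrix ((Q.toLeft e he hI).h i) p).rank =
      ((Q.d i).map (p.rep ∘ₗ e.toLinearMap)).rank :=
  (rank_submatrix ((Q.d i).map (p.rep ∘ₗ e.toLinearMap))ᵀ _ _).trans (rank_transpose _)

theorem ColumnResolution.mem_toRight_X_iff {I : Submodule k A} (Q : ColumnResolution ι I)
    (hQ : Q.HasLinearPart) (e : V ≃ₗ[k] 𝒜 1) (he : ∀ v, (e v : A) = ι v)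
    (hI : ∀ a, a ∈ I ↔ a ∈ augmentation 𝒜) {p : ℙ k (Module.Dual k (𝒜 1))} :
    p ∈ (Q.toRight e he hI).X ↔ ∃ q ≠ 0, RelationZero ι q (p.rep ∘ₗ e.toLinearMap) := by
  rw [RightLinearResolution.X, mem_minorLocus_iff, rank_evalMatrix_toRight, ← e.finrank_eq,
    hQ.finrank_eq]
  exact hQ.rank_lt_iff

theorem ColumnResolution.mem_toLeft_X_iff {I : Submodule k Aᵐᵒᵖ}
    (Q : ColumnResolution (opMap ι) I) (hQ : Q.HasLinearPart) (e : V ≃ₗ[k] 𝒜 1)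
    (he : ∀ v, (e v : A) = ι v) (hI : ∀ a, op a ∈ I ↔ a ∈ augmentation 𝒜)
    {p : ℙ k (Module.Dual k (𝒜 1))} :
    p ∈ (Q.toLeft e he hI).X ↔ ∃ q ≠ 0, RelationZero ι (p.rep ∘ₗ e.toLinearMap) q := by
  rw [LeftLinearResolution.X, mem_minorLocus_iff, rank_evalMatrix_toLeft, ← e.finrank_eq,
    hQ.finrank_eq]
  refine hQ.rank_lt_iff.trans ?_
  simp only [opMap, relationZero_op]

end Points

/-! ### Transport of regular maps along a linear isomorphism. -/

section Transport

variable {k V W : Type*} [Field k] [AddCommGroup V] [Module k V] [AddCommGroup W] [Module k W]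

/-- The isomorphism of projective spaces induced by a linear isomorphism. -/
def pointEquiv (e : V ≃ₗ[k] W) : ℙ k (Module.Dual k W) ≃ ℙ k (Module.Dual k V) where
  toFun := Projectivization.map e.dualMap.toLinearMap e.dualMap.injective
  invFun := Projectivization.map e.dualMap.symm.toLinearMap e.dualMap.symm.injective
  left_inv x := by
    induction x using Projectivization.ind with | _ v hv =>
    rw [Projectivization.map_mk, Projectivization.map_mk]
    congr 1
    exact e.dualMap.symm_apply_apply v
  right_inv x := by
    induction x using Projectivization.ind with | _ v hv =>
    rw [Projectivization.map_mk, Projectivization.map_mk]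
    congr 1
    exact e.dualMap.apply_symm_apply v

theorem exists_pointEquiv_rep (e : V ≃ₗ[k] W) (x : ℙ k (Module.Dual k W)) :
    ∃ a : kˣ, a • (x.rep ∘ₗ e.toLinearMap) = (pointEquiv e x).rep := by
  have h : x.rep ∘ₗ e.toLinearMap ≠ 0 := fun h0 => x.rep_nonzero (e.dualMap.injective (by
    rw [map_zero]; exact h0))
  obtain ⟨a, ha⟩ := Projectivization.exists_smul_eq_mk_rep k _ h
  refine ⟨a, ha.trans ?_⟩
  conv_rhs => rw [← x.mk_rep]
  rfl

theorem aeval_mul_of_isHomogeneous {S : Type*} {F : MvPolynomial S k} {n : ℕ}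
    (hF : F.IsHomogeneous n) (a : k) (g : S → k) :
    MvPolynomial.aeval (fun i => a * g i) F = a ^ n * MvPolynomial.aeval g F := by
  simp only [MvPolynomial.aeval_def, MvPolynomial.eval₂_eq, Finset.mul_sum]
  refine Finset.sum_congr rfl fun d hd => ?_
  rw [hF.degree_eq_sum_deg_support hd]
  simp only [mul_pow, Finset.prod_mul_distrib, Finset.prod_pow_eq_pow_sum]
  ring

theorem polyEval_pointEquiv (e : V ≃ₗ[k] W) {x : ℙ k (Module.Dual k W)} {a : k}
    (ha : a • (x.rep ∘ₗ e.toLinearMap) = (pointEquiv e x).rep) {F : MvPolynomial V k} {n : ℕ}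
    (hF : F.IsHomogeneous n) :
    polyEval (pointEquiv e x) F = a ^ n * polyEval x (MvPolynomial.rename e F) := by
  rw [polyEval, polyEval, ← ha, MvPolynomial.aeval_rename]
  exact aeval_mul_of_isHomogeneous hF a _

/-- Renaming variables along `e` transports the local formulas. A change of representative scales
homogeneous values by powers of a unit, which affects neither nonvanishing nor the projective point.
`E'` may correspond to a proper subset of `E`, so restriction is included. -/
theorem isRegularMap_transport (e : V ≃ₗ[k] W) {E : Set (ℙ k (Module.Dual k V))}
    {φ : E → ℙ k (Module.Dual k V)} (hφ : IsRegularMap E φ) {E' : Set (ℙ k (Module.Dual k W))}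
    (hE : ∀ x ∈ E', pointEquiv e x ∈ E) :
    IsRegularMap E' fun x => (pointEquiv e).symm (φ ⟨pointEquiv e x.1, hE x.1 x.2⟩) := by
  intro p
  obtain ⟨n, d, G, F, hG, hF, hp, h⟩ := hφ ⟨_, hE p.1 p.2⟩
  refine ⟨n, d, MvPolynomial.rename e G,
    (MvPolynomial.rename e).toLinearMap ∘ₗ F ∘ₗ e.symm.toLinearMap, hG.rename_isHomogeneous,
    fun w => (hF _).rename_isHomogeneous, ?_, fun q hq => ?_⟩
  · obtain ⟨a, ha⟩ := exists_pointEquiv_rep e p.1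
    rw [polyEval_pointEquiv e (a := a) ha hG] at hp
    exact right_ne_zero_of_mul hp
  · obtain ⟨a, ha⟩ := exists_pointEquiv_rep e q.1
    obtain ⟨h0, h1⟩ := h ⟨_, hE q.1 q.2⟩ (by
      rw [polyEval_pointEquiv e (a := a) ha hG]
      exact mul_ne_zero (pow_ne_zero _ a.ne_zero) hq)
    have key : tupleEval F (pointEquiv e q.1) = (a ^ d) • e.dualMap
        (tupleEval ((MvPolynomial.rename e).toLinearMap ∘ₗ F ∘ₗ e.symm.toLinearMap) q.1) := by
      ext v
      have := polyEval_pointEquiv e (a := a) ha (hF v)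
      simpa [tupleEval, polyEval, Units.smul_def] using this
    refine ⟨fun hz => h0 (by rw [key, hz, map_zero, smul_zero]), ?_⟩
    rw [Equiv.symm_apply_eq, h1]
    exact (Projectivization.mk_eq_mk_iff k _ _ _ _).2 ⟨a ^ d, key.symm⟩

end Transport

/-! ### Point symmetry from either hypothesis. -/

section PointSymmetric

variable {k : Type u} [Field k] {A : Type v} [Ring A] [Algebra k A] {𝒜 : ℕ → Submodule k A}

theorem isDegreeOnePart_subtype : IsDegreeOnePart 𝒜 (𝒜 1).subtype :=
  ⟨Subtype.val_injective, Submodule.range_subtype _⟩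

theorem IsSemiStandard.isPointSymmetric [GradedAlgebra 𝒜] (hconn : IsConnectedGraded 𝒜)
    (h : IsSemiStandard 𝒜) : IsPointSymmetric (𝒜 1).subtype := by
  obtain ⟨P, Q, hPQ⟩ := h
  have hP := fun p => P.mem_X_iff (p := p) (hasLinearPart hconn isDegreeOnePart_subtype _)
  have hQ := fun p => Q.mem_X_iff (p := p)
    (hasLinearPart (isConnectedGraded_op hconn) isDegreeOnePart_subtype.op _)
  intro p hp
  obtain ⟨a, ha⟩ := Projectivization.exists_smul_eq_mk_rep k p hp
  have h1 := hP (Projectivization.mk k p hp)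
  rw [hPQ, hQ, ← ha] at h1
  have hr : ∀ q, RelationZero (𝒜 1).subtype q (a • p) ↔ RelationZero (𝒜 1).subtype q p :=
    fun q => by simpa using relationZero_units_smul (q := q) (p := p) (1 : kˣ) a
  have hl : ∀ q, RelationZero (𝒜 1).subtype (a • p) q ↔ RelationZero (𝒜 1).subtype p q :=
    fun q => by simpa using relationZero_units_smul (q := p) (p := q) a (1 : kˣ)
  simp only [hr, hl] at h1
  exact h1.symm

/-- Having a successor means lying in `E`, having a predecessor means lying in the image of `σ`, and
`σ` maps `E` onto itself. -/
theorem SatisfiesG1.isPointSymmetric (h : SatisfiesG1 𝒜) : IsPointSymmetric (𝒜 1).subtype := by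
  obtain ⟨E, σ, -, -, hgraph⟩ := h
  have hmem : ∀ {q p : ℙ k (Module.Dual k (𝒜 1))},
      RelationZero (𝒜 1).subtype q.rep p.rep ↔ ∃ x : E, q = x.1 ∧ p = (σ x).1 := fun {q p} => by
    rw [← mem_bilinearZeros_iff, hgraph]
    simp only [Set.mem_ofPred_eq, Prod.mk.injEq]
  intro p hp
  constructor
  · rintro ⟨q, hq, h⟩
    obtain ⟨x, -, hx⟩ := hmem.1 ((relationZero_mk_rep hq hp).2 h)
    refine ⟨(σ (σ x)).1.rep, Projectivization.rep_nonzero _, ?_⟩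
    have h2 := hmem.2 ⟨σ x, rfl, rfl⟩
    rw [← hx] at h2
    rwa [← Projectivization.mk_rep (σ (σ x)).1, relationZero_mk_rep] at h2
  · rintro ⟨r, hr, h⟩
    obtain ⟨x, hx, -⟩ := hmem.1 ((relationZero_mk_rep hp hr).2 h)
    refine ⟨(σ.symm x).1.rep, Projectivization.rep_nonzero _, ?_⟩
    have h2 := hmem.2 ⟨σ.symm x, rfl, rfl⟩
    rw [σ.apply_symm_apply, ← hx] at h2
    rwa [← Projectivization.mk_rep (σ.symm x).1, relationZero_mk_rep] at h2

end PointSymmetric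

/-! ### Semi-standardness, point-exactness and (G1) for the quotient. -/

section Main

variable {k : Type u} [Field k] {A : Type v} [Ring A] [Algebra k A] {𝒜 : ℕ → Submodule k A}
  {f : A}

variable (k) in
/-- The projection `A → A / (f)`. -/
def quotientMap (f : A) : A →ₐ[k] QuotientBy f :=
  (TwoSidedIdeal.span {f}).ringCon.mkₐ k

/-- By normality the right ideal `fA` is two-sided, so it is the whole ideal generated by `f`. -/
theorem isQuotientBy_quotientMap (hnormal : IsNormalElement f) :
    IsQuotientBy (quotientMap k f) f := by
  refine ⟨RingCon.mkₐ_surjective _, fun a => ?_⟩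
  have h1 : quotientMap k f a = 0 ↔ a ∈ TwoSidedIdeal.span {f} :=
    (RingCon.eq _).trans (TwoSidedIdeal.mem_iff _ _).symm
  rw [h1]
  constructor
  · intro h
    let S : Set A := {a | ∃ b, a = f * b}
    have := TwoSidedIdeal.mem_span_iff.1 h (TwoSidedIdeal.mk' S
      ⟨0, (mul_zero f).symm⟩
      (by rintro _ _ ⟨b, rfl⟩ ⟨c, rfl⟩; exact ⟨b + c, (mul_add _ _ _).symm⟩)
      (by rintro _ ⟨b, rfl⟩; exact ⟨-b, (mul_neg _ _).symm⟩)
      (by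
        rintro x _ ⟨b, rfl⟩
        obtain ⟨c, hc⟩ := hnormal.exists_mul_eq x
        exact ⟨c * b, by rw [← mul_assoc, hc, mul_assoc]⟩)
      (by rintro _ y ⟨b, rfl⟩; exact ⟨b * y, mul_assoc _ _ _⟩))
      (by
        rintro _ rfl
        exact (TwoSidedIdeal.mem_mk' S _ _ _ _ _ _).2 ⟨1, (mul_one _).symm⟩)
    exact (TwoSidedIdeal.mem_mk' S _ _ _ _ _ _).1 this
  · rintro ⟨b, rfl⟩
    exact TwoSidedIdeal.mul_mem_right _ _ _ (TwoSidedIdeal.subset_span rfl)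

variable [GradedAlgebra 𝒜]

theorem eq_zero_of_quotientMap_eq_zero (hf : f ∈ 𝒜 2) (hnormal : IsNormalElement f) {a : A} (ha : a ∈ 𝒜 1)
    (h : quotientMap k f a = 0) : a = 0 := by
  obtain ⟨b, hb⟩ := ((isQuotientBy_quotientMap hnormal).eq_zero_iff a).1 h
  rw [← decompose_of_mem_same 𝒜 ha, hb]
  exact coe_decompose_mul_of_left_mem_of_not_le 𝒜 hf (by omega)

/-- The degree one component of `A / (f)` is that of `A`. -/
noncomputable def degreeOneEquiv (hf : f ∈ 𝒜 2) (hnormal : IsNormalElement f) :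
    𝒜 1 ≃ₗ[k] quotientGrading 𝒜 f 1 :=
  LinearEquiv.ofBijective
    (((quotientMap k f).toLinearMap ∘ₗ (𝒜 1).subtype).codRestrict (quotientGrading 𝒜 f 1)
      fun v => ⟨v, v.2, rfl⟩)
    ⟨(injective_iff_map_eq_zero _).2 fun v hv => Subtype.ext
      (eq_zero_of_quotientMap_eq_zero hf hnormal v.2 (congrArg Subtype.val hv)), by
      rintro ⟨_, a, ha, rfl⟩
      exact ⟨⟨a, ha⟩, rfl⟩⟩

theorem coe_degreeOneEquiv (hf : f ∈ 𝒜 2) (hnormal : IsNormalElement f) (v : 𝒜 1) :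
    (degreeOneEquiv hf hnormal v : QuotientBy f) =
      ((quotientMap k f).toLinearMap ∘ₗ (𝒜 1).subtype) v := rfl

variable [FiniteDimensional k (𝒜 1)]

/-- Symmetry over `A` extends a successive pair to a triple, and the chain lemma carries the
vanishing of `f` from one pair of the triple to the other. -/
theorem IsPointSymmetric.quotient (hconn : IsConnectedGraded 𝒜) (hf : f ∈ 𝒜 2)
    (hreg : IsRegular f) (hnormal : IsNormalElement f)
    (P : ColumnResolution (𝒜 1).subtype (augmentation 𝒜))
    (h : IsPointSymmetric (𝒜 1).subtype) :
    IsPointSymmetric ((quotientMap k f).toLinearMap ∘ₗ (𝒜 1).subtype) := by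
  obtain ⟨N⟩ := exists_normalTwist isDegreeOnePart_subtype hf hreg hnormal
  have hchain := fun {r q p : Module.Dual k (𝒜 1)} => relationZero_quotient_chain (r := r) (q := q)
    (p := p) hconn isDegreeOnePart_subtype hf (isQuotientBy_quotientMap hnormal) N P
  intro p hp
  constructor
  · rintro ⟨q, hq, hqp⟩
    obtain ⟨r, hr, hpr⟩ := (h p hp).1 ⟨q, hq, hqp.of_quotient⟩
    exact ⟨r, hr, (hchain hq hr hqp.of_quotient hpr).2 hqp⟩
  · rintro ⟨r, hr, hpr⟩
    obtain ⟨q, hq, hqp⟩ := (h p hp).2 ⟨r, hr, hpr.of_quotient⟩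
    exact ⟨q, hq, (hchain hq hr hqp hpr.of_quotient).1 hpr⟩

/-- Common core of both parts of the theorem. The extra resolution `R` makes the point locus of the
quotient available as a determinantal variety for (G1). -/
theorem isPointExactUpTo_quotient (hconn : IsConnectedGraded 𝒜) (hf : f ∈ 𝒜 2)
    (hreg : IsRegular f) (hnormal : IsNormalElement f) {ℓ : ℕ} (hA : IsPointExactUpTo 𝒜 ℓ)
    (hsym : IsPointSymmetric (𝒜 1).subtype) :
    IsSemiStandard (quotientGrading 𝒜 f) ∧ IsPointExactUpTo (quotientGrading 𝒜 f) ℓ ∧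
      ∃ R : RightLinearResolution (quotientGrading 𝒜 f), ∀ p, p ∈ R.X ↔
        ∃ q ≠ 0, RelationZero ((quotientMap k f).toLinearMap ∘ₗ (𝒜 1).subtype) q
          (p.rep ∘ₗ (degreeOneEquiv hf hnormal).toLinearMap) := by
  obtain ⟨⟨P, hP⟩, ⟨Q, hQ⟩⟩ := hA
  have hι := isDegreeOnePart_subtype (𝒜 := 𝒜)
  have hπ := isQuotientBy_quotientMap (k := k) hnormal
  have hPX := fun p => P.mem_X_iff (p := p) (hasLinearPart hconn hι _)
  have hQX := fun p => Q.mem_X_iff (p := p) (hasLinearPart (isConnectedGraded_op hconn) hι.op _)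
  obtain ⟨P', hP', hPr⟩ := exists_quotient_resolution hconn hι hf hreg hnormal hπ P.toColumn
  obtain ⟨Q', hQ', hQr⟩ := exists_quotient_resolution (isConnectedGraded_op hconn) hι.op
    (op_mem_opGrading.2 hf) (isRegular_op hreg) (isNormalElement_op hnormal) (hπ.op hnormal)
    Q.toColumn
  let e := degreeOneEquiv hf hnormal
  have he := coe_degreeOneEquiv hf hnormal
  have haug : augmentation (quotientGrading 𝒜 f) =
      (augmentation 𝒜).map (quotientMap k f).toLinearMap := (Submodule.map_iSup _ _).symm
  have hI : ∀ a, a ∈ (augmentation 𝒜).map (quotientMap k f).toLinearMap ↔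
      a ∈ augmentation (quotientGrading 𝒜 f) := fun a => by rw [haug]
  have hI' : ∀ a, op a ∈ (augmentation (opGrading 𝒜)).map
      (AlgHom.op (quotientMap k f)).toLinearMap ↔ a ∈ augmentation (quotientGrading 𝒜 f) := by
    intro a
    rw [haug]
    constructor
    · rintro ⟨x, hx, hxa⟩
      exact ⟨x.unop, mem_augmentation_op.1 hx, op_injective hxa⟩
    · rintro ⟨x, hx, rfl⟩
      exact ⟨op x, mem_augmentation_op.2 hx, rfl⟩
  have hne : ∀ p : ℙ k (Module.Dual k (quotientGrading 𝒜 f 1)), p.rep ∘ₗ e.toLinearMap ≠ 0 :=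
    fun p h0 => p.rep_nonzero (e.dualMap.injective (by rw [map_zero]; exact h0))
  -- The opposite of the composite is definitionally the composite of the opposites.
  let Q'' : ColumnResolution (opMap ((quotientMap k f).toLinearMap ∘ₗ (𝒜 1).subtype)) _ := Q'
  have hPX' := fun p => P'.mem_toRight_X_iff hP' e he hI (p := p)
  have hQX' := fun p => Q''.mem_toLeft_X_iff hQ' e he hI' (p := p)
  have hsym' := hsym.quotient hconn hf hreg hnormal P.toColumn
  refine ⟨⟨P'.toRight e he hI, Q''.toLeft e he hI', ?_⟩, ⟨⟨P'.toRight e he hI, ?_⟩,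
    ⟨Q''.toLeft e he hI', ?_⟩⟩, ⟨P'.toRight e he hI, hPX'⟩⟩
  · ext p
    rw [hPX', hQX']
    exact hsym' _ (hne p)
  · intro j hj p hp
    rw [P'.rank_evalMatrix_toRight, P'.rank_evalMatrix_toRight]
    refine hPr ℓ (fun j hj p hp hpq => ?_) (fun q hq h => (hsym q hq).2 h) j hj _ (hne p)
      ((hPX' p).1 hp)
    obtain ⟨q, hq, hqp⟩ := hpq
    have := hP j hj (Projectivization.mk k p hp) ((hPX _).2 ⟨_, Projectivization.rep_nonzero _,
      (relationZero_mk_rep hq hp).2 hqp⟩)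
    rw [evalMatrix, evalMatrix, rank_map_mk_rep, rank_map_mk_rep] at this
    exact this.trans (Fintype.card_fin _).symm
  · intro j hj p hp
    rw [Q''.rank_evalMatrix_toLeft, Q''.rank_evalMatrix_toLeft]
    obtain ⟨q, hq, hpq⟩ := (hQX' p).1 hp
    refine hQr ℓ (fun j hj p hp hpq => ?_) (fun q hq h => ?_) j hj _ (hne p)
      ⟨q, hq, relationZero_op.2 hpq⟩
    · obtain ⟨q, hq, hqp⟩ := hpq
      have := hQ j hj (Projectivization.mk k p hp) ((hQX _).2 ⟨_, Projectivization.rep_nonzero _,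
        (relationZero_mk_rep hp hq).2 (relationZero_op.1 hqp)⟩)
      rw [evalMatrix, evalMatrix, rank_map_mk_rep, rank_map_mk_rep] at this
      refine Eq.trans ?_ (this.trans (Fintype.card_fin _).symm)
      exact congrArg₂ _ (rank_transpose ((Q.h j).map p)) (rank_transpose ((Q.h (j + 1)).map p))
    · obtain ⟨p, hp, hqp⟩ := h
      obtain ⟨r, hr, hqr⟩ := (hsym q hq).1 ⟨p, hp, relationZero_op.1 hqp⟩
      exact ⟨r, hr, relationZero_op.2 hqr⟩

/-- The variety is the determinantal locus of `R`, identified through `ψ` with a subset of `E`. The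
two directions of the chain lemma make it stable under `σ` and its inverse. -/
theorem satisfiesG1_quotient (hconn : IsConnectedGraded 𝒜) (hf : f ∈ 𝒜 2)
    (hreg : IsRegular f) (hnormal : IsNormalElement f)
    (P : ColumnResolution (𝒜 1).subtype (augmentation 𝒜)) (hG : SatisfiesG1 𝒜)
    (R : RightLinearResolution (quotientGrading 𝒜 f))
    (hR : ∀ p, p ∈ R.X ↔
        ∃ q ≠ 0, RelationZero ((quotientMap k f).toLinearMap ∘ₗ (𝒜 1).subtype) q
          (p.rep ∘ₗ (degreeOneEquiv hf hnormal).toLinearMap)) :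
    SatisfiesG1 (quotientGrading 𝒜 f) := by
  obtain ⟨N⟩ := exists_normalTwist isDegreeOnePart_subtype hf hreg hnormal
  obtain ⟨E, σ, -, ⟨hσ, hσ'⟩, hgraph⟩ := hG
  let ι' := (quotientMap k f).toLinearMap ∘ₗ (𝒜 1).subtype
  let e := degreeOneEquiv hf hnormal
  let ψ := pointEquiv e
  let Z : ℙ k (Module.Dual k (𝒜 1)) → ℙ k (Module.Dual k (𝒜 1)) → Prop :=
    fun q p => RelationZero ι' q.rep p.rep
  have hmem : ∀ {q p : ℙ k (Module.Dual k (𝒜 1))},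
      RelationZero (𝒜 1).subtype q.rep p.rep ↔ ∃ x : E, q = x.1 ∧ p = (σ x).1 := fun {q p} => by
    rw [← mem_bilinearZeros_iff, hgraph]
    simp only [Set.mem_ofPred_eq, Prod.mk.injEq]
  have hchain : ∀ (x : E), Z x (σ x) ↔ Z (σ x) (σ (σ x)) := fun x =>
    (relationZero_quotient_chain hconn isDegreeOnePart_subtype hf (isQuotientBy_quotientMap hnormal)
      N P (Projectivization.rep_nonzero _) (Projectivization.rep_nonzero _)
      (hmem.2 ⟨x, rfl, rfl⟩) (hmem.2 ⟨σ x, rfl, rfl⟩)).symm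
  have hgr : ∀ {q p}, Z q p → ∃ x : E, q = x.1 ∧ p = (σ x).1 := fun h =>
    hmem.1 (RelationZero.of_quotient h)
  have hZψ : ∀ x y, RelationZero (quotientGrading 𝒜 f 1).subtype x.rep y.rep ↔ Z (ψ x) (ψ y) := by
    intro x y
    obtain ⟨a, ha⟩ := exists_pointEquiv_rep e x
    obtain ⟨b, hb⟩ := exists_pointEquiv_rep e y
    change _ ↔ RelationZero ι' (pointEquiv e x).rep (pointEquiv e y).rep
    rw [← ha, ← hb, relationZero_units_smul]
    exact (relationZero_comp_equiv e (coe_degreeOneEquiv hf hnormal)).symm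
  have hX : ∀ x, x ∈ R.X ↔ ∃ q, Z q (ψ x) := by
    intro x
    obtain ⟨b, hb⟩ := exists_pointEquiv_rep e x
    have h1 : ∀ q, RelationZero ι' q (ψ x).rep ↔ RelationZero ι' q (x.rep ∘ₗ e.toLinearMap) :=
      fun q => by
        change RelationZero ι' q (pointEquiv e x).rep ↔ _
        rw [← hb]
        simpa using relationZero_units_smul (ι := ι') (q := q) (p := x.rep ∘ₗ e.toLinearMap)
          (1 : kˣ) b
    rw [hR]
    constructor
    · rintro ⟨q, hq, h⟩
      refine ⟨Projectivization.mk k q hq, ?_⟩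
      have := (relationZero_mk_rep hq (ψ x).rep_nonzero).2 ((h1 q).2 h)
      rwa [Projectivization.mk_rep] at this
    · rintro ⟨q, h⟩
      exact ⟨q.rep, q.rep_nonzero, (h1 _).1 h⟩
  have hE : ∀ x ∈ R.X, ψ x ∈ E := fun x hx => by
    obtain ⟨q, hq⟩ := (hX x).1 hx
    obtain ⟨y, -, hy⟩ := hgr hq
    rw [hy]
    exact (σ y).2
  -- A predecessor over `B` forces `σ` to give a successor over `B`: `f` vanishes on the incoming
  -- pair, hence on the outgoing one.
  have hZ : ∀ (x) (hx : x ∈ R.X), Z (ψ x) (σ ⟨ψ x, hE x hx⟩) := fun x hx => by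
    obtain ⟨q, hq⟩ := (hX x).1 hx
    obtain ⟨y, hy1, hy2⟩ := hgr hq
    have h1 : (⟨ψ x, hE x hx⟩ : E) = σ y := Subtype.ext hy2
    rw [h1]
    change Z (ψ x) _
    rw [hy2]
    exact (hchain y).1 (by rw [← hy1, ← hy2]; exact hq)
  have hfwd : ∀ (x) (hx : x ∈ R.X), ψ.symm (σ ⟨ψ x, hE x hx⟩).1 ∈ R.X := fun x hx =>
    (hX _).2 ⟨ψ x, by rw [ψ.apply_symm_apply]; exact hZ x hx⟩
  have hbwd : ∀ (x) (hx : x ∈ R.X), ψ.symm (σ.symm ⟨ψ x, hE x hx⟩).1 ∈ R.X := fun x hx => by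
    obtain ⟨q, hq⟩ := (hX x).1 hx
    obtain ⟨y, hy1, hy2⟩ := hgr hq
    have h1 : σ.symm ⟨ψ x, hE x hx⟩ = y := σ.symm_apply_eq.2 (Subtype.ext hy2)
    refine (hX _).2 ⟨(σ.symm y).1, ?_⟩
    rw [ψ.apply_symm_apply, h1]
    have h2 := hchain (σ.symm y)
    rw [σ.apply_symm_apply] at h2
    exact h2.2 (by rw [← hy1, ← hy2]; exact hq)
  let σ' : R.X ≃ R.X :=
    { toFun := fun x => ⟨_, hfwd x.1 x.2⟩
      invFun := fun x => ⟨_, hbwd x.1 x.2⟩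
      left_inv := fun x => by simp
      right_inv := fun x => by simp }
  refine ⟨R.X, σ', isProjectiveVariety_minorLocus _ _, ⟨isRegularMap_transport e hσ hE,
    isRegularMap_transport e hσ' hE⟩, ?_⟩
  ext ⟨x, y⟩
  rw [mem_bilinearZeros_iff, hZψ]
  constructor
  · intro h
    obtain ⟨z, hz1, hz2⟩ := hgr h
    have hy : y ∈ R.X := (hX y).2 ⟨_, h⟩
    have h1 : σ.symm ⟨ψ y, hE y hy⟩ = z := σ.symm_apply_eq.2 (Subtype.ext hz2)
    have hx : x ∈ R.X := by
      have := hbwd y hy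
      rwa [h1, ← hz1, ψ.symm_apply_apply] at this
    refine ⟨⟨x, hx⟩, Prod.ext rfl ?_⟩
    change y = ψ.symm (σ ⟨ψ x, hE x hx⟩).1
    rw [Equiv.eq_symm_apply, hz2]
    exact congrArg (fun z => (σ z).1) (Subtype.ext hz1.symm)
  · rintro ⟨z, hz⟩
    obtain ⟨rfl, hz2⟩ := Prod.ext_iff.1 hz
    dsimp only at hz2
    have h1 : ψ y = (σ ⟨ψ z, hE z z.2⟩).1 := by
      rw [hz2]
      exact ψ.apply_symm_apply _
    change Z (ψ z.1) (ψ y)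
    rw [h1]
    exact hZ z.1 z.2

end Main

end PointExact

theorem theorem5p3 {k : Type u} [Field k] [IsAlgClosed k] [CharZero k]
    {A : Type v} [Ring A] [Algebra k A]
    (𝒜 : ℕ → Submodule k A) [GradedAlgebra 𝒜] (hconn : PointExact.IsConnectedGraded 𝒜)
    [FiniteDimensional k (𝒜 1)] (hKoszul : PointExact.IsKoszul 𝒜)
    (f : A) (hf : f ∈ 𝒜 2) (hreg : IsRegular f) (hnormal : PointExact.IsNormalElement f)
    (ℓ : ℕ) (hℓ : 2 ≤ ℓ) :
    (PointExact.IsSemiStandard 𝒜 ∧ PointExact.IsPointExactUpTo 𝒜 ℓ →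
      PointExact.IsSemiStandard (PointExact.quotientGrading 𝒜 f) ∧
        PointExact.IsPointExactUpTo (PointExact.quotientGrading 𝒜 f) ℓ) ∧
    (PointExact.SatisfiesG1 𝒜 ∧ PointExact.IsPointExactUpTo 𝒜 ℓ →
      PointExact.SatisfiesG1 (PointExact.quotientGrading 𝒜 f) ∧
        PointExact.IsPointExactUpTo (PointExact.quotientGrading 𝒜 f) ℓ) := by
  constructor
  · rintro ⟨hsemi, hexact⟩
    have h := PointExact.isPointExactUpTo_quotient hconn hf hreg hnormal hexact
      (hsemi.isPointSymmetric hconn)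
    exact ⟨h.1, h.2.1⟩
  · rintro ⟨hG, hexact⟩
    obtain ⟨-, h, R, hR⟩ := PointExact.isPointExactUpTo_quotient hconn hf hreg hnormal hexact
      hG.isPointSymmetric
    obtain ⟨⟨P, -⟩, -⟩ := hexact
    exact ⟨PointExact.satisfiesG1_quotient hconn hf hreg hnormal P.toColumn hG R hR, h⟩
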